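/- Let $K$ be an algebraically closed field and $d\ge 2$, $N,M\ge 0$ integers. For an endomorphism $f=[f_0,\dots,f_N]$ of $\mathbb{P}^N$ over $K$ given by homogeneous polynomials of degree $d$ without a common zero, and $n\ge1$, put $$\Sigma_n(f)=\prod_{P}\bigl(w-\gamma_{f^n,P}(t)\bigr)\in K[w,t],$$ where $P$ runs over the fixed points of the iterate $f^n$, taken with multiplicity (the length of the local ring of the fixed point scheme at $P$), and $\gamma_{f^n,P}(t)$ is the characteristic polynomial of the differential of $f^n$ at $P$. Let $D_n$ be the number of these points counted with multiplicity and write $\Sigma_n(f)=\sum_{i=0}^{D_n}\sum_{j=0}^{Ni}(-1)^{i+j}\sigma^{(n)}_{i,j}\,w^{D_n-i}t^{Ni-j}$. A family of degree $d$ endomorphisms of $\mathbb{P}^N$ is called isospectral if, for every $n\ge1$, all the invariants $\sigma^{(k)}_{i,j}$ with $1\le k\le n$ take the same values on all members of the family. Let $g=[y_0^d,\dots,y_M^d]$ be the degree $d$ powering map on $\mathbb{P}^M$. For a degree $d$ endomorphism $f$ of $\mathbb{P}^N$, say that an endomorphism $h=[h_{ij}]_{0\le i\le N,\,0\le j\le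 M}$ of $\mathbb{P}^{(N+1)(M+1)-1}$ of degree $d$, in coordinates $z_{kl}$, is induced by $f\times g$ through the Segre embedding $z_{kl}=x_ky_l$ if it is obtained by rewriting the monomials of the $f_i(x)g_j(y)$ in terms of the $z_{kl}=x_ky_l$; that is, if, up to a common nonzero scalar factor, $h_{ij}(x_ky_l)=f_i(x)g_j(y)$ for all $i,j$, and every monomial occurring in $h_{ij}$ becomes under $z_{kl}\mapsto x_ky_l$ a monomial occurring in $f_i(x)g_j(y)$. **Theorem.** Let $(f_a)_a$ be an isospectral family of degree $d$ endomorphisms of $\mathbb{P}^N$. Then for every $a$ there is exactly one endomorphism $h_a$ of $\mathbb{P}^{(N+1)(M+1)-1}$ of degree $d$ induced by $f_a\times g$ through the Segre embedding, and the family $(h_a)_a$ is isospectral. Moreover, there is a permutation of the coordinates, independent of $a$, after which $h_a$ is the cartesian product of $M+1$ copies of $f_a$, i.e. the map that acts by the coordinate functions of $f_a$ on each of $M+1$ disjoint blocks of $N+1$ coordinates. -/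

import Mathlib

open scoped LinearAlgebra.Projectivization

/-- A degree `d` endomorphism of the projective space with homogeneous coordinates indexed by `σ`
(so `ℙ^N` is the case `σ = Fin (N + 1)`), given by homogeneous coordinate functions of degree `d`
without a common zero.  Over an algebraically closed field these are exactly the tuples with
nonvanishing Macaulay resultant.  Two tuples define the same endomorphism exactly when they are
proportional, see `ProjEndo.SameMap`. -/
structure ProjEndo (K : Type*) [Field K] (σ : Type*) (d : ℕ) where
  coord : σ → MvPolynomial σ K
  homog : ∀ i, (coord i).IsHomogeneous d
  no_common_zero : ∀ v : σ → K, v ≠ 0 → ∃ i, MvPolynomial.eval v (coord i) ≠ 0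

namespace ProjEndo

section Maps

variable {K : Type*} [Field K] {σ τ : Type*} {d e : ℕ}

/-- Two coordinate tuples define the same endomorphism of projective space. -/
def SameMap (f g : ProjEndo K σ d) : Prop :=
  ∃ c : K, c ≠ 0 ∧ ∀ i, f.coord i = MvPolynomial.C c * g.coord i

/-- The identity, of degree one. -/
noncomputable def id : ProjEndo K σ 1 where
  coord i := MvPolynomial.X i
  homog i := MvPolynomial.isHomogeneous_X K i
  no_common_zero v hv := by
    obtain ⟨i, hi⟩ := Function.ne_iff.mp hv
    exact ⟨i, by simpa using hi⟩

/-- The composite `f ∘ g`. -/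
noncomputable def comp (f : ProjEndo K σ d) (g : ProjEndo K σ e) : ProjEndo K σ (e * d) where
  coord i := MvPolynomial.bind₁ g.coord (f.coord i)
  homog i := (f.homog i).aeval g.coord g.homog
  no_common_zero v hv := by
    obtain ⟨k, hk⟩ := g.no_common_zero v hv
    obtain ⟨i, hi⟩ := f.no_common_zero (fun j => MvPolynomial.eval v (g.coord j))
      (fun h => hk (congrFun h k))
    refine ⟨i, ?_⟩
    rw [MvPolynomial.eval, MvPolynomial.eval₂Hom_bind₁]
    exact hi

/-- The `n`-th iterate `f^n = f ∘ f^{n-1}`. -/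
noncomputable def iter (f : ProjEndo K σ d) : (n : ℕ) → ProjEndo K σ (d ^ n)
  | 0 => id
  | n + 1 => comp f (iter f n)

/-- The induced map on the points of projective space. -/
noncomputable def onPoints (f : ProjEndo K σ d) (P : ℙ K (σ → K)) : ℙ K (σ → K) :=
  Projectivization.mk K (fun i => MvPolynomial.eval P.rep (f.coord i)) (by
    obtain ⟨i, hi⟩ := f.no_common_zero P.rep P.rep_nonzero
    exact fun h => hi (congrFun h i))

/-- The set of fixed points. -/
def fixedPts (f : ProjEndo K σ d) : Set (ℙ K (σ → K)) :=
  {P | f.onPoints P = P}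

end Maps

section Multipliers

variable {K : Type*} [Field K] {σ : Type*} {d : ℕ}

/-- A coordinate that does not vanish at `P`. -/
noncomputable def chart (P : ℙ K (σ → K)) : σ :=
  (Function.ne_iff.mp P.rep_nonzero).choose

/-- The coordinate vector of `P` whose `chart P` coordinate is `1`. -/
noncomputable def affineRep (P : ℙ K (σ → K)) : σ → K :=
  fun i => P.rep i / P.rep (chart P)

/-- The Jacobian matrix at `p` (where `p j = 1`) of the dehomogenization
`φ_v = f_v / f_j`, `v ≠ j`, of `f` in the affine chart `x_j = 1`, whose coordinates are the
`x_w` with `w ≠ j`. -/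
noncomputable def jacobian (f : ProjEndo K σ d) (j : σ) (p : σ → K) :
    Matrix {v : σ // v ≠ j} {v : σ // v ≠ j} K :=
  Matrix.of fun v w =>
    (MvPolynomial.eval p (MvPolynomial.pderiv w.1 (f.coord v.1)) *
        MvPolynomial.eval p (f.coord j) -
      MvPolynomial.eval p (MvPolynomial.pderiv w.1 (f.coord j)) *
        MvPolynomial.eval p (f.coord v.1)) /
      MvPolynomial.eval p (f.coord j) ^ 2

open Classical in
/-- The multiplier polynomial `γ_{f,P}(t)` at a fixed point `P`: the characteristic polynomial of
the differential of `f` at `P`, computed in an affine chart around `P`. -/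
noncomputable def multiplierPoly [Fintype σ] (f : ProjEndo K σ d) (P : ℙ K (σ → K)) :
    Polynomial K :=
  (f.jacobian (chart P) (affineRep P)).charpoly

/-- The ideal of the fixed point scheme of `f` in the affine chart `x_j = 1`, the chart being
regarded as a hyperplane of affine space.  The scheme is cut out by the `2 × 2` minors of the matrix
with rows `x` and `f(x)`; in the chart they generate the same ideal as the
`f_v - x_v f_j`, `v ≠ j`. -/
noncomputable def fixedIdeal (f : ProjEndo K σ d) (j : σ) : Ideal (MvPolynomial σ K) :=
  Ideal.span ({MvPolynomial.X j - 1} ∪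
    {q | ∃ v w : σ, q = MvPolynomial.X v * f.coord w - MvPolynomial.X w * f.coord v})

/-- The maximal ideal of the point `p` of affine space. -/
noncomputable abbrev pointIdeal (p : σ → K) : Ideal (MvPolynomial σ K) :=
  RingHom.ker (MvPolynomial.eval p : MvPolynomial σ K →+* K)

instance pointIdeal_isPrime (p : σ → K) : (pointIdeal p).IsPrime :=
  RingHom.ker_isPrime _

/-- The multiplicity of a fixed point `P`: the dimension over `K` of the local ring at `P` of the
fixed point scheme. -/
noncomputable def fixedMult (f : ProjEndo K σ d) (P : ℙ K (σ → K)) : ℕ :=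
  Module.finrank K (Localization.AtPrime (pointIdeal (affineRep P)) ⧸
    (f.fixedIdeal (chart P)).map
      (algebraMap (MvPolynomial σ K) (Localization.AtPrime (pointIdeal (affineRep P)))))

/-- The number `D_n` of points of period `n` (fixed points of `f^n`), counted with
multiplicity. -/
noncomputable def numPer (f : ProjEndo K σ d) (n : ℕ) : ℕ :=
  ∑ᶠ P ∈ (f.iter n).fixedPts, (f.iter n).fixedMult P

/-- `Σ_n(f) = ∏_P (w - γ_{f^n,P}(t))`, the product over the points of period `n` taken with
multiplicity, as a polynomial in `w` (the outer variable) over `K[t]`. -/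
noncomputable def bigSigma [Fintype σ] (f : ProjEndo K σ d) (n : ℕ) :
    Polynomial (Polynomial K) :=
  ∏ᶠ P ∈ (f.iter n).fixedPts,
    (Polynomial.X - Polynomial.C ((f.iter n).multiplierPoly P)) ^ (f.iter n).fixedMult P

/-- The multiplier invariant `σ_{i,j}^{(n)}`: `(-1)^(i+j)` times the coefficient of
`w^(D_n - i) t^(N i - j)` in `Σ_n(f)`, where `N` is the dimension of the projective space.  The
labels are `0 ≤ i ≤ D_n`, `0 ≤ j ≤ N i`; the value is set to `0` for other `i`, `j`. -/
noncomputable def multInv [Fintype σ] (f : ProjEndo K σ d) (n i j : ℕ) : K :=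
  if i ≤ f.numPer n ∧ j ≤ (Fintype.card σ - 1) * i then
    (-1) ^ (i + j) *
      (((f.bigSigma n).coeff (f.numPer n - i)).coeff ((Fintype.card σ - 1) * i - j))
  else 0

/-- The multiplier map `τ_{d,n}^N`: the complete sets of invariants `σ_{i,j}^{(k)}` for the
periods `k = 1, …, n`. -/
noncomputable def multMap [Fintype σ] (f : ProjEndo K σ d) (n : ℕ) : Fin n → ℕ → ℕ → K :=
  fun k i j => f.multInv (k + 1) i j

/-- Two endomorphisms are isospectral if they have the same image under all the multiplier maps. -/
def Isospectral [Fintype σ] (f g : ProjEndo K σ d) : Prop :=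
  ∀ n : ℕ, f.multMap n = g.multMap n

/-- A family is isospectral if all the multiplier maps are constant on it. -/
def IsospectralFamily [Fintype σ] {ι : Type*} (f : ι → ProjEndo K σ d) : Prop :=
  ∀ a b : ι, Isospectral (f a) (f b)

end Multipliers

section Constructions

variable {K : Type*} [Field K] {σ τ κ : Type*} {d : ℕ}

/-- The degree `d` powering map `[y_0, …, y_M] ↦ [y_0^d, …, y_M^d]`. -/
noncomputable def power (K : Type*) [Field K] (τ : Type*) (d : ℕ) : ProjEndo K τ d where
  coord j := MvPolynomial.X j ^ d
  homog j := MvPolynomial.isHomogeneous_X_pow j d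
  no_common_zero v hv := by
    obtain ⟨i, hi⟩ := Function.ne_iff.mp hv
    exact ⟨i, by simpa using fun h => absurd h hi⟩

/-- The cartesian product of the endomorphisms `f j`, `j : κ`, of the same degree: the coordinates
are divided into blocks indexed by `κ`, and `f j` acts on the block `j`. -/
noncomputable def cartProd (f : κ → ProjEndo K σ d) : ProjEndo K (κ × σ) d where
  coord q := MvPolynomial.rename (fun k => (q.1, k)) ((f q.1).coord q.2)
  homog q := ((f q.1).homog q.2).rename_isHomogeneous
  no_common_zero v hv := by
    obtain ⟨⟨j, k⟩, hk⟩ := Function.ne_iff.mp hv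
    obtain ⟨i, hi⟩ := (f j).no_common_zero (fun k => v (j, k)) (fun h => hk (congrFun h k))
    refine ⟨(j, i), ?_⟩
    rw [MvPolynomial.eval_rename]
    exact hi

/-- The endomorphism obtained by relabelling the homogeneous coordinates along `e`. -/
noncomputable def permute (e : σ ≃ τ) (f : ProjEndo K σ d) : ProjEndo K τ d where
  coord k := MvPolynomial.rename e (f.coord (e.symm k))
  homog k := (f.homog (e.symm k)).rename_isHomogeneous
  no_common_zero v hv := by
    obtain ⟨k, hk⟩ := Function.ne_iff.mp hv
    obtain ⟨i, hi⟩ := f.no_common_zero (v ∘ e)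
      (fun h => hk (by simpa using congrFun h (e.symm k)))
    refine ⟨e i, ?_⟩
    rw [MvPolynomial.eval_rename, Equiv.symm_apply_apply]
    exact hi

/-- Pullback of polynomials along the Segre embedding `z_{kl} = x_k y_l`; the coordinates `x` and
`y` of the two factors are labelled by the two summands of `σ ⊕ τ`. -/
noncomputable def segrePullback (K : Type*) [Field K] (σ τ : Type*) :
    MvPolynomial (σ × τ) K →ₐ[K] MvPolynomial (σ ⊕ τ) K :=
  MvPolynomial.aeval fun q => MvPolynomial.X (Sum.inl q.1) * MvPolynomial.X (Sum.inr q.2)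

/-- The coordinate `f_i(x) g_j(y)` of the composite of `f × g` with the Segre embedding. -/
noncomputable def segreCoord (f : ProjEndo K σ d) (g : ProjEndo K τ d) (q : σ × τ) :
    MvPolynomial (σ ⊕ τ) K :=
  MvPolynomial.rename Sum.inl (f.coord q.1) * MvPolynomial.rename Sum.inr (g.coord q.2)

/-- `h` is induced by `f × g` through the Segre embedding: its coordinates are obtained from the
`f_i(x) g_j(y)` by rewriting monomials in terms of `z_{kl} = x_k y_l`.  That is, `h` restricts to
`f × g` on the Segre variety (first condition, up to a common scalar), and no superfluous terms
are added: each monomial occurring in `h_{ij}` pulls back to a monomial occurring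
in `f_i(x) g_j(y)`. -/
def SegreInduced (f : ProjEndo K σ d) (g : ProjEndo K τ d) (h : ProjEndo K (σ × τ) d) : Prop :=
  (∃ c : K, c ≠ 0 ∧ ∀ q, segrePullback K σ τ (h.coord q) = MvPolynomial.C c * segreCoord f g q) ∧
  ∀ q, ∀ m ∈ (h.coord q).support,
    (segrePullback K σ τ (MvPolynomial.monomial m 1)).support ⊆ (segreCoord f g q).support

end Constructions

end ProjEndo

/-! Every monomial of `f_i(x) y_j ^ d` has `y_j` as its only `y`-variable, so `h_{ij}` can involve
only the `z_{kj}` with this same `j`. On polynomials in these variables the Segre pullback is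
injective on setting `y = 1`. Hence `h_{ij} = f_i(z_{0j}, …, z_{Nj})` up to the common scalar: `h`
is `rowwise`, the cartesian product of copies of `f` (`segreInduced_rowwise`,
`SegreInduced.sameMap_rowwise`).

Fixed points of a cartesian product in projective space are not tuples of fixed points, so the
spectra are compared on affine cones, where they are. Let `F` be the homogeneous lift of `f`. Its
fixed scheme consists of the origin, of multiplicity one and with zero differential because `d ≥ 2`,
and, over each fixed point `P` of `f`, of points of total multiplicity `(d - 1) * fixedMult P` on
the line `P`. By Euler's relation such a point is an eigenvector of the differential of `F` with
eigenvalue `d`, and the action on the quotient is the differential of `f` at `P`. So the spectrum of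
`F` consists of `t ^ (N + 1)` and `d - 1` copies of the `(t - d) γ_P` (`coneSpectrum_eq`); it
determines the spectrum of `f` and is determined by it.

For a product of copies of `f`, the fixed scheme of the lift is a product: multiplicities and
characteristic polynomials multiply. As elements of the monoid algebra of `K[t]` over `ℕ`, the cone
spectrum of the product is thus the `(M + 1)`-st power of that of `f`
(`IsBlockPower.formalSum_coneSpectrum`). Iteration commutes with the product, and isospectrality
amounts to equality of the spectra of all iterates (`isospectral_iff_spectrum`), which finishes the
argument. -/

namespace ProjEndo

/-! ### Local multiplicities of zero-dimensional affine schemes -/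

section LocalMultiplicity

open MvPolynomial

variable {K : Type*} [Field K] {σ : Type*}

/-- The dimension of the local ring at `p` of the closed subscheme of affine space cut out
by `I`. -/
noncomputable def localMult (I : Ideal (MvPolynomial σ K)) (p : σ → K) : ℕ :=
  Module.finrank K (Localization.AtPrime (pointIdeal p) ⧸
    I.map (algebraMap (MvPolynomial σ K) (Localization.AtPrime (pointIdeal p))))

theorem fixedMult_eq_localMult {d : ℕ} (f : ProjEndo K σ d) (P : ℙ K (σ → K)) :
    f.fixedMult P = localMult (f.fixedIdeal (chart P)) (affineRep P) := rfl

/-- The contraction to the polynomial ring of the extension of `I` to the local ring at `p`. -/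
def localSat (I : Ideal (MvPolynomial σ K)) (p : σ → K) : Ideal (MvPolynomial σ K) where
  carrier := {r | ∃ s, eval p s ≠ 0 ∧ s * r ∈ I}
  zero_mem' := ⟨1, by simp, by simp⟩
  add_mem' := by
    rintro a b ⟨s, hs, hsa⟩ ⟨t, ht, htb⟩
    refine ⟨s * t, by simp [hs, ht], ?_⟩
    have := I.add_mem (I.mul_mem_left t hsa) (I.mul_mem_left s htb)
    convert this using 1
    ring
  smul_mem' := by
    rintro c a ⟨s, hs, hsa⟩
    refine ⟨s, hs, ?_⟩
    have := I.mul_mem_left c hsa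
    convert this using 1
    simp only [smul_eq_mul]
    ring

theorem mem_localSat {I : Ideal (MvPolynomial σ K)} {p : σ → K} {r : MvPolynomial σ K} :
    r ∈ localSat I p ↔ ∃ s, eval p s ≠ 0 ∧ s * r ∈ I := Iff.rfl

theorem le_localSat (I : Ideal (MvPolynomial σ K)) (p : σ → K) : I ≤ localSat I p :=
  fun r hr => ⟨1, by simp, by simpa using hr⟩

theorem localSat_mono {I J : Ideal (MvPolynomial σ K)} (h : I ≤ J) (p : σ → K) :
    localSat I p ≤ localSat J p :=
  fun _ ⟨s, hs, hsr⟩ => ⟨s, hs, h hsr⟩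

theorem localSat_le_of_le {I J : Ideal (MvPolynomial σ K)} {p : σ → K} (h : J ≤ localSat I p) :
    localSat J p ≤ localSat I p := by
  rintro r ⟨s, hs, hsr⟩
  obtain ⟨t, ht, htr⟩ := h hsr
  exact ⟨t * s, by simp [hs, ht], by rwa [mul_assoc]⟩

theorem localSat_eq_top {I : Ideal (MvPolynomial σ K)} {p : σ → K} {r : MvPolynomial σ K}
    (hr : r ∈ I) (hp : eval p r ≠ 0) : localSat I p = ⊤ :=
  (Ideal.eq_top_iff_one _).mpr ⟨r, hp, by simpa using hr⟩

theorem eval_eq_zero_of_mem_localSat {I : Ideal (MvPolynomial σ K)} {p : σ → K}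
    (hI : I ≤ pointIdeal p) {r : MvPolynomial σ K} (hr : r ∈ localSat I p) : eval p r = 0 := by
  obtain ⟨s, hs, hsr⟩ := hr
  have := hI hsr
  rw [RingHom.mem_ker, map_mul] at this
  exact (mul_eq_zero.mp this).resolve_left hs

theorem comap_map_localization (I : Ideal (MvPolynomial σ K)) (p : σ → K) :
    (I.map (algebraMap _ (Localization.AtPrime (pointIdeal p)))).comap (algebraMap _ _) =
      localSat I p := by
  ext r
  rw [Ideal.mem_comap,
    IsLocalization.algebraMap_mem_map_algebraMap_iff (pointIdeal p).primeCompl, mem_localSat]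
  rfl

/-- Modulo `J`, the polynomial `s` is the sum of a nonzero constant and a nilpotent element, hence a
unit. -/
theorem exists_mul_sub_one_mem {J : Ideal (MvPolynomial σ K)} {p : σ → K} {k : ℕ}
    (hk : pointIdeal p ^ k ≤ J) {s : MvPolynomial σ K} (hs : eval p s ≠ 0) :
    ∃ t, s * t - 1 ∈ J := by
  have h1 : C (eval p s) - s ∈ pointIdeal p := by simp [RingHom.mem_ker]
  have h2 : IsNilpotent (Ideal.Quotient.mk J (C (eval p s) - s)) := by
    refine ⟨k, ?_⟩
    rw [← map_pow]
    exact Ideal.Quotient.eq_zero_iff_mem.mpr (hk (Ideal.pow_mem_pow h1 k))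
  have h3 : IsUnit (Ideal.Quotient.mk J (C (eval p s))) :=
    ((isUnit_iff_ne_zero.mpr hs).map C).map _
  have h4 : IsUnit (Ideal.Quotient.mk J s) := by
    have := h2.isUnit_add_left_of_commute h3.neg (Commute.all _ _)
    have h5 := this.neg
    simpa using h5
  obtain ⟨u, hu⟩ := h4.exists_right_inv
  obtain ⟨t, rfl⟩ := Ideal.Quotient.mk_surjective u
  refine ⟨t, ?_⟩
  rw [← Ideal.Quotient.eq, map_mul, hu, map_one]

theorem localSat_le_of_pow_le {I J : Ideal (MvPolynomial σ K)} {p : σ → K} {k : ℕ}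
    (hIJ : I ≤ J) (hk : pointIdeal p ^ k ≤ J) : localSat I p ≤ J := by
  rintro r ⟨s, hs, hsr⟩
  obtain ⟨t, ht⟩ := exists_mul_sub_one_mem hk hs
  have h1 := J.mul_mem_left t (hIJ hsr)
  have h2 := J.mul_mem_right r ht
  have := J.sub_mem h1 h2
  convert this using 1
  ring

/-- Elements not vanishing at `p` are already invertible modulo `localSat I p`, so localizing adds
nothing. From here on lengths are computed in quotients of the polynomial ring. -/
theorem localMult_eq_finrank {I : Ideal (MvPolynomial σ K)} {p : σ → K} {k : ℕ}
    (hk : pointIdeal p ^ k ≤ localSat I p) :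
    localMult I p = Module.finrank K (MvPolynomial σ K ⧸ localSat I p) := by
  let L := Localization.AtPrime (pointIdeal p)
  let IL := I.map (algebraMap (MvPolynomial σ K) L)
  let φ : MvPolynomial σ K →ₐ[K] L ⧸ IL :=
    (Ideal.Quotient.mkₐ K IL).comp (IsScalarTower.toAlgHom K (MvPolynomial σ K) L)
  have hker : RingHom.ker φ = localSat I p := by
    rw [← comap_map_localization]
    ext r
    rw [RingHom.mem_ker, Ideal.mem_comap]
    exact Ideal.Quotient.eq_zero_iff_mem
  have hsurj : Function.Surjective φ := by
    intro y
    obtain ⟨x, rfl⟩ := Ideal.Quotient.mk_surjective y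
    obtain ⟨r, s, rfl⟩ := IsLocalization.exists_mk'_eq (pointIdeal p).primeCompl x
    obtain ⟨t, ht⟩ := exists_mul_sub_one_mem hk (p := p) (s := s.1) s.2
    refine ⟨r * t, ?_⟩
    change Ideal.Quotient.mk IL (algebraMap _ L (r * t)) = _
    rw [← comap_map_localization, Ideal.mem_comap] at ht
    rw [Ideal.Quotient.eq]
    have := IL.mul_mem_left (IsLocalization.mk' L r s) ht
    convert this using 1
    rw [map_sub, map_mul, map_one, map_mul, mul_sub, ← mul_assoc, mul_one]
    exact congrArg (· * _ - _) (IsLocalization.mk'_spec L r s).symm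
  have e := Ideal.quotientKerAlgEquivOfSurjective hsurj
  rw [localMult, ← hker]
  exact e.toLinearEquiv.finrank_eq.symm

/-- In the Artinian quotient the powers of the ideal `m` of `p` stabilize, and Nakayama's lemma
gives an element congruent to `1` modulo `m` that kills the stable power. If `p` is not a zero of
`I`, the saturation is everything. -/
theorem exists_pow_le_localSat [Finite σ] (I : Ideal (MvPolynomial σ K))
    [Module.Finite K (MvPolynomial σ K ⧸ I)] (p : σ → K) :
    ∃ k, pointIdeal p ^ k ≤ localSat I p := by
  have : IsArtinianRing (MvPolynomial σ K ⧸ I) := IsArtinianRing.of_finite K _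
  let m : Ideal (MvPolynomial σ K ⧸ I) := (pointIdeal p).map (Ideal.Quotient.mk I)
  obtain ⟨k, hk⟩ := IsArtinian.monotone_stabilizes (R := MvPolynomial σ K ⧸ I)
    (M := MvPolynomial σ K ⧸ I)
    ⟨fun k => OrderDual.toDual (m ^ k), fun a b h => Ideal.pow_le_pow_right h⟩
  have hk1 : m ^ k = m ^ (k + 1) := hk (k + 1) (Nat.le_succ k)
  obtain ⟨r, hr1, hr⟩ := Submodule.exists_sub_one_mem_and_smul_eq_zero_of_fg_of_le_smul m (m ^ k)
    (IsNoetherian.noetherian _) (by rw [smul_eq_mul, ← pow_succ', ← hk1])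
  obtain ⟨s, rfl⟩ := Ideal.Quotient.mk_surjective r
  refine ⟨k, fun x hx => ?_⟩
  by_cases hI : I ≤ pointIdeal p
  · refine ⟨s, ?_, ?_⟩
    · have h1 : s - 1 ∈ pointIdeal p := by
        rw [← map_one (Ideal.Quotient.mk I), ← map_sub] at hr1
        have := Ideal.mem_comap.mpr hr1
        rwa [Ideal.comap_map_of_surjective _ Ideal.Quotient.mk_surjective, ← RingHom.ker_eq_comap_bot,
          Ideal.mk_ker, sup_eq_left.mpr hI] at this
      rw [RingHom.mem_ker, map_sub, map_one, sub_eq_zero] at h1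
      rw [h1]
      exact one_ne_zero
    · have := hr (Ideal.Quotient.mk I x) (by
        rw [← Ideal.map_pow]
        exact Ideal.mem_map_of_mem _ hx)
      rwa [smul_eq_mul, ← map_mul, Ideal.Quotient.eq_zero_iff_mem] at this
  · obtain ⟨r, hr, hrp⟩ := Set.not_subset.mp hI
    rw [localSat_eq_top hr hrp]
    trivial

theorem localMult_congr {I J : Ideal (MvPolynomial σ K)} {p : σ → K}
    (h : localSat I p = localSat J p) {k : ℕ} (hk : pointIdeal p ^ k ≤ localSat I p) :
    localMult I p = localMult J p := by
  rw [localMult_eq_finrank hk, localMult_eq_finrank (h ▸ hk), h]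

theorem isCoprime_pointIdeal {p q : σ → K} (h : p ≠ q) :
    IsCoprime (pointIdeal p) (pointIdeal q) := by
  obtain ⟨i, hi⟩ := Function.ne_iff.mp h
  rw [Ideal.isCoprime_iff_exists]
  have hne : q i - p i ≠ 0 := sub_ne_zero.mpr hi.symm
  refine ⟨C (q i - p i)⁻¹ * (X i - C (p i)), by simp [RingHom.mem_ker],
    -C (q i - p i)⁻¹ * (X i - C (q i)), by simp [RingHom.mem_ker], ?_⟩
  have h1 : C (q i - p i)⁻¹ * (X i - C (p i)) + -C (q i - p i)⁻¹ * (X i - C (q i)) =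
      (C ((q i - p i)⁻¹ * (q i - p i)) : MvPolynomial σ K) := by
    rw [map_mul, map_sub]
    ring
  rw [h1, inv_mul_cancel₀ hne, map_one]

theorem finite_zeros [Finite σ] (I : Ideal (MvPolynomial σ K))
    [Module.Finite K (MvPolynomial σ K ⧸ I)] : {p : σ → K | I ≤ pointIdeal p}.Finite := by
  classical
  refine (Set.Finite.pi' fun i =>
    (minpoly K (Ideal.Quotient.mk I (X i))).roots.toFinset.finite_toSet).subset fun p hp i => ?_
  have hint : IsIntegral K (Ideal.Quotient.mk I (X i)) := Algebra.IsIntegral.isIntegral _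
  let ψ : (MvPolynomial σ K ⧸ I) →ₐ[K] K := Ideal.Quotient.liftₐ I (aeval p) fun a ha => by
    have := hp ha
    rwa [RingHom.mem_ker, ← aeval_eq_eval] at this
  have hψ : ψ (Ideal.Quotient.mk I (X i)) = p i := by
    change aeval p (X i) = p i
    simp
  rw [Finset.mem_coe, Multiset.mem_toFinset, Polynomial.mem_roots (minpoly.ne_zero hint),
    Polynomial.IsRoot, ← hψ, ← Polynomial.coe_aeval_eq_eval, Polynomial.aeval_algHom_apply,
    minpoly.aeval, map_zero]

variable [IsAlgClosed K]

/-- The weak Nullstellensatz. -/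
theorem exists_le_pointIdeal [Finite σ] {I : Ideal (MvPolynomial σ K)} (hI : I ≠ ⊤) :
    ∃ p : σ → K, I ≤ pointIdeal p := by
  obtain ⟨M, hM, hIM⟩ := Ideal.exists_le_maximal I hI
  obtain ⟨p, rfl⟩ := isMaximal_iff_eq_vanishingIdeal_singleton.mp hM
  refine ⟨p, fun r hr => ?_⟩
  have := hIM hr
  rw [mem_vanishingIdeal_singleton_iff] at this
  simpa [RingHom.mem_ker, aeval_eq_eval] using this

/-- If `r` is in every saturation but not in `I`, the ideal `(I : r)` is proper and so has a zero
`p`, which is a zero of `I`. But some element of `(I : r)` does not vanish at `p`. -/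
theorem iInf_localSat [Finite σ] (I : Ideal (MvPolynomial σ K)) {S : Set (σ → K)}
    (hS : ∀ p, I ≤ pointIdeal p → p ∈ S) : ⨅ p : S, localSat I p = I := by
  refine le_antisymm (fun r hr => ?_) (le_iInf fun p => le_localSat I p)
  rw [Ideal.mem_iInf] at hr
  by_contra hrI
  have hne : I.colon {r} ≠ ⊤ := by
    intro h
    have h1 := (Ideal.eq_top_iff_one _).mp h
    rw [Submodule.mem_colon_singleton] at h1
    exact hrI (by simpa using h1)
  obtain ⟨p, hp⟩ := exists_le_pointIdeal hne
  have hIp : I ≤ pointIdeal p := fun x hx => hp (by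
    rw [Submodule.mem_colon_singleton]
    exact I.mul_mem_right r hx)
  obtain ⟨s, hs, hsr⟩ := hr ⟨p, hS p hIp⟩
  exact hs (hp (Submodule.mem_colon_singleton.mpr hsr))

/-- Chinese remainder theorem: the saturations at distinct points are coprime, as they contain
powers of distinct maximal ideals, and they intersect in `I`. -/
theorem finrank_quotient_eq_sum_localMult [Finite σ] (I : Ideal (MvPolynomial σ K))
    [Module.Finite K (MvPolynomial σ K ⧸ I)] {S : Finset (σ → K)}
    (hS : ∀ p, I ≤ pointIdeal p → p ∈ S) :
    Module.finrank K (MvPolynomial σ K ⧸ I) = ∑ p ∈ S, localMult I p := by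
  choose k hk using exists_pow_le_localSat I
  have hcop : Pairwise (Function.onFun IsCoprime fun p : S => localSat I p.1) := by
    intro p q hpq
    have := (isCoprime_pointIdeal (Subtype.coe_ne_coe.mpr hpq)).pow (m := k p) (n := k q)
    rw [Function.onFun, Ideal.isCoprime_iff_sup_eq, eq_top_iff] at *
    exact this.trans (sup_le_sup (hk _) (hk _))
  have hfin : ∀ p : S, Module.Finite K (MvPolynomial σ K ⧸ localSat I p.1) := fun p =>
    Module.Finite.of_surjective
      (Ideal.Quotient.factorₐ K (le_localSat I p.1)).toLinearMap
      (Ideal.Quotient.factor_surjective (le_localSat I p.1))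
  let φ : MvPolynomial σ K →ₗ[K] ∀ p : S, MvPolynomial σ K ⧸ localSat I p.1 :=
    LinearMap.pi fun p => (Ideal.Quotient.mkₐ K (localSat I p.1)).toLinearMap
  have hφ : Function.Surjective φ := fun x => by
    obtain ⟨r, hr⟩ := Ideal.pi_quotient_surjective hcop x
    exact ⟨r, funext hr⟩
  have hker : LinearMap.ker φ = I.restrictScalars K := by
    ext r
    have h := congrArg (r ∈ ·) (iInf_localSat I (S := (S : Set (σ → K))) hS)
    simp only [Ideal.mem_iInf, eq_iff_iff] at h
    rw [LinearMap.mem_ker, Submodule.restrictScalars_mem, ← h, funext_iff]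
    exact forall_congr' fun p => Ideal.Quotient.eq_zero_iff_mem
  have e := LinearMap.quotKerEquivOfSurjective φ hφ
  rw [hker] at e
  rw [show Module.finrank K (MvPolynomial σ K ⧸ I) = _ from e.finrank_eq, Module.finrank_pi_fintype,
    ← Finset.sum_coe_sort S]
  exact Finset.sum_congr rfl fun p _ => (localMult_eq_finrank (hk p)).symm

/-- The product of the `X i - p i` over the zeros `p` vanishes on the zero locus, so by the
Nullstellensatz a power of it lies in `I`. Each coordinate is therefore integral over `K`. -/
theorem finite_quotient_of_finite_zeros [Finite σ] {I : Ideal (MvPolynomial σ K)}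
    (hI : {p : σ → K | I ≤ pointIdeal p}.Finite) : Module.Finite K (MvPolynomial σ K ⧸ I) := by
  have hX : ∀ i, IsIntegral K (Ideal.Quotient.mk I (X i)) := by
    intro i
    let q : Polynomial K := ∏ p ∈ hI.toFinset, (Polynomial.X - Polynomial.C (p i))
    have hq : Polynomial.aeval (X i) q ∈ I.radical := by
      rw [← vanishingIdeal_zeroLocus_eq_radical (K := K), mem_vanishingIdeal_iff]
      intro p hp
      have hmem : p ∈ hI.toFinset := by
        rw [Set.Finite.mem_toFinset]
        intro r hr
        simpa [RingHom.mem_ker, aeval_eq_eval] using hp r hr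
      rw [← Polynomial.aeval_algHom_apply, aeval_X, map_prod]
      exact Finset.prod_eq_zero hmem (by simp)
    obtain ⟨n, hn⟩ := hq
    refine ⟨q ^ n, (Polynomial.monic_prod_of_monic _ _ fun p _ =>
      Polynomial.monic_X_sub_C _).pow n, ?_⟩
    rw [← Polynomial.aeval_def, ← Ideal.Quotient.mkₐ_eq_mk K, Polynomial.aeval_algHom_apply,
      map_pow]
    exact Ideal.Quotient.eq_zero_iff_mem.mpr hn
  have hint : Algebra.IsIntegral K (MvPolynomial σ K ⧸ I) := by
    refine ⟨fun x => ?_⟩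
    obtain ⟨r, rfl⟩ := Ideal.Quotient.mk_surjective x
    induction r using MvPolynomial.induction_on with
    | C a => exact isIntegral_algebraMap (R := K) (A := MvPolynomial σ K ⧸ I) (x := a)
    | add p q hp hq => rw [map_add]; exact hp.add hq
    | mul_X p i hp => rw [map_mul]; exact hp.mul (hX i)
  exact Algebra.IsIntegral.finite

end LocalMultiplicity

/-! ### Fixed points of the homogeneous lift -/

section Cone

open MvPolynomial

variable {K : Type*} [Field K] {σ : Type*} {d : ℕ}

theorem homogeneousComponent_mul_of_isHomogeneous {F : MvPolynomial σ K} (hF : F.IsHomogeneous d)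
    (b : MvPolynomial σ K) {e : ℕ} (he : d ≤ e) :
    homogeneousComponent e (b * F) = homogeneousComponent (e - d) b * F := by
  have h1 : ∀ i, homogeneousComponent e (homogeneousComponent i b * F) =
      if i = e - d then homogeneousComponent i b * F else 0 := by
    intro i
    rw [homogeneousComponent_of_mem ((homogeneousComponent_isHomogeneous i b).mul hF)]
    congr 1
    rw [eq_iff_iff]
    omega
  by_cases hd : e - d ∈ Finset.range (b.totalDegree + 1)
  · conv_lhs => rw [← sum_homogeneousComponent b, Finset.sum_mul, map_sum]
    rw [Finset.sum_congr rfl fun i _ => h1 i, Finset.sum_ite_eq', if_pos hd]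
  · conv_lhs => rw [← sum_homogeneousComponent b, Finset.sum_mul, map_sum]
    rw [Finset.sum_congr rfl fun i _ => h1 i, Finset.sum_ite_eq', if_neg hd,
      homogeneousComponent_eq_zero _ _ (by rw [Finset.mem_range] at hd; omega), zero_mul]

/-- The ideal of the scheme of fixed points of the homogeneous lift of `f` to affine space. -/
noncomputable def coneIdeal (f : ProjEndo K σ d) : Ideal (MvPolynomial σ K) :=
  Ideal.span (Set.range fun i => f.coord i - X i)

theorem coneIdeal_le_pointIdeal {f : ProjEndo K σ d} {v : σ → K} :
    f.coneIdeal ≤ pointIdeal v ↔ ∀ i, eval v (f.coord i) = v i := by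
  rw [coneIdeal, Ideal.span_le]
  constructor
  · intro h i
    have := h ⟨i, rfl⟩
    simpa [RingHom.mem_ker, sub_eq_zero] using this
  · rintro h _ ⟨i, rfl⟩
    simp [RingHom.mem_ker, h]

theorem eval_zero_coord (f : ProjEndo K σ d) (hd : d ≠ 0) (i : σ) : eval 0 (f.coord i) = 0 := by
  rw [eval_zero, constantCoeff_eq]
  exact (f.homog i).coeff_eq_zero (by simpa using hd.symm)

theorem aeval_mul_of_isHomogeneous {A : Type*} [CommRing A] [Algebra K A] {F : MvPolynomial σ K}
    (hF : F.IsHomogeneous d) (c : A) (g : σ → A) :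
    aeval (fun i => c * g i) F = c ^ d * aeval g F := by
  rw [aeval_def, aeval_def, eval₂_eq, eval₂_eq, Finset.mul_sum]
  refine Finset.sum_congr rfl fun m hm => ?_
  have hdeg : d = m.degree := hF.degree_eq_sum_deg_support hm
  rw [mul_left_comm]
  congr 1
  rw [hdeg, Finsupp.degree_apply, ← Finset.prod_pow_eq_pow_sum, ← Finset.prod_mul_distrib]
  exact Finset.prod_congr rfl fun k _ => mul_pow _ _ _

theorem eval_smul_of_isHomogeneous {F : MvPolynomial σ K} {e : ℕ} (hF : F.IsHomogeneous e) (c : K)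
    (v : σ → K) : eval (c • v) F = c ^ e * eval v F := by
  have := aeval_mul_of_isHomogeneous (A := K) hF c v
  rwa [aeval_eq_eval, aeval_eq_eval] at this

theorem eval_smul_coord (f : ProjEndo K σ d) (c : K) (v : σ → K) (i : σ) :
    eval (c • v) (f.coord i) = c ^ d * eval v (f.coord i) :=
  eval_smul_of_isHomogeneous (f.homog i) c v

theorem localMult_eq_one {I : Ideal (MvPolynomial σ K)} {p : σ → K}
    (h : localSat I p = pointIdeal p) : localMult I p = 1 := by
  rw [localMult_eq_finrank (k := 1) (by rw [pow_one, h]), h]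
  have hs : Function.Surjective (aeval p : MvPolynomial σ K →ₐ[K] K) := fun c =>
    ⟨C c, by simp⟩
  have e := Ideal.quotientKerAlgEquivOfSurjective hs
  have := e.toLinearEquiv.finrank_eq
  rwa [Module.finrank_self] at this

theorem pointIdeal_zero_eq_idealOfVars : pointIdeal (0 : σ → K) = idealOfVars σ K := by
  ext r
  rw [RingHom.mem_ker, eval_zero, ← pow_one (idealOfVars σ K), mem_pow_idealOfVars_iff',
    constantCoeff_eq]
  simp only [Nat.lt_one_iff, Finsupp.degree_eq_zero_iff, forall_eq]

variable [Fintype σ] [IsAlgClosed K]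

/-- Projective Nullstellensatz: the coordinate functions have no common zero except possibly the
origin. -/
theorem exists_idealOfVars_pow_le (f : ProjEndo K σ d) :
    ∃ T, idealOfVars σ K ^ T ≤ Ideal.span (Set.range f.coord) := by
  refine Ideal.exists_pow_le_of_le_radical_of_fg ?_ (IsNoetherian.noetherian _)
  rw [idealOfVars, Ideal.span_le, ← vanishingIdeal_zeroLocus_eq_radical (K := K)]
  rintro _ ⟨i, rfl⟩ v hv
  by_contra hne
  obtain ⟨j, hj⟩ := f.no_common_zero v fun h => hne (by simp [h])
  exact hj (by simpa [aeval_eq_eval] using hv _ (Ideal.subset_span ⟨j, rfl⟩))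

/-- A form of large degree is a combination of the `f_i` with homogeneous coefficients. Modulo the
cone ideal each `f_i` may be replaced by `X i`, which lowers the degree by `d - 1 > 0`. By induction
the polynomials of degree at most `T + d` span the quotient. -/
theorem finite_quotient_coneIdeal (f : ProjEndo K σ d) (hd : 2 ≤ d) :
    Module.Finite K (MvPolynomial σ K ⧸ f.coneIdeal) := by
  obtain ⟨T, hT⟩ := f.exists_idealOfVars_pow_le
  let π := (Ideal.Quotient.mkₐ K f.coneIdeal).toLinearMap
  let W := (restrictTotalDegree σ K (T + d)).map π
  have hX : ∀ i, π (f.coord i) = π (X i) := fun i =>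
    Ideal.Quotient.eq.mpr (Ideal.subset_span ⟨i, rfl⟩)
  have key : ∀ e, ∀ p : MvPolynomial σ K, p.IsHomogeneous e → π p ∈ W := by
    intro e
    induction e using Nat.strong_induction_on with
    | _ e ih =>
      intro p hp
      by_cases he : e ≤ T + d
      · exact Submodule.mem_map_of_mem
          ((mem_restrictTotalDegree _ _ _).mpr (hp.totalDegree_le.trans he))
      · have hpJ : p ∈ Ideal.span (Set.range f.coord) := hT (by
          rw [mem_pow_idealOfVars_iff]
          intro m hm
          have : e = m.degree := hp.degree_eq_sum_deg_support hm
          omega)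
        obtain ⟨b, hb⟩ := (Ideal.mem_span_range_iff_exists_fun).mp hpJ
        have hp' : p = ∑ i, homogeneousComponent (e - d) (b i) * f.coord i := by
          rw [← homogeneousComponent_eq_self hp, ← hb, map_sum]
          exact Finset.sum_congr rfl fun i _ =>
            homogeneousComponent_mul_of_isHomogeneous (f.homog i) _ (by omega)
        have hp2 : π p = ∑ i, π (homogeneousComponent (e - d) (b i) * X i) := by
          rw [hp', map_sum]
          refine Finset.sum_congr rfl fun i _ => ?_
          have h1 : ∀ x y, π (x * y) = π x * π y := fun x y => map_mul (Ideal.Quotient.mkₐ K f.coneIdeal) x y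
          rw [h1, h1, hX]
        rw [hp2]
        exact Submodule.sum_mem _ fun i _ => ih (e - d + 1) (by omega) _
          ((homogeneousComponent_isHomogeneous _ _).mul (isHomogeneous_X _ _))
  refine Module.Finite.of_surjective (π.comp (restrictTotalDegree σ K (T + d)).subtype) ?_
  rw [← LinearMap.range_eq_top, LinearMap.range_comp, Submodule.range_subtype, eq_top_iff]
  rintro x -
  obtain ⟨p, rfl⟩ := Ideal.Quotient.mk_surjective x
  change π p ∈ W
  rw [← sum_homogeneousComponent p, map_sum]
  exact Submodule.sum_mem _ fun i _ => key i _ (homogeneousComponent_isHomogeneous i p)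

/-- Near the origin `X i ≡ f_i`, and `f_i` lies in `m ^ 2` since `d ≥ 2`. So `m ≤ Q + m ^ 2`, which
iterates to `m ≤ Q + m ^ (k + 1)`, while `Q` contains `m ^ k`. The origin is thus a reduced fixed
point. -/
theorem localSat_coneIdeal_zero (f : ProjEndo K σ d) (hd : 2 ≤ d) :
    localSat f.coneIdeal 0 = pointIdeal 0 := by
  have := f.finite_quotient_coneIdeal hd
  obtain ⟨k, hk⟩ := exists_pow_le_localSat f.coneIdeal (0 : σ → K)
  have hle : f.coneIdeal ≤ pointIdeal (0 : σ → K) := coneIdeal_le_pointIdeal.mpr fun i =>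
    eval_zero_coord f (by omega) i
  refine le_antisymm (fun r hr => eval_eq_zero_of_mem_localSat hle hr) ?_
  set Q := localSat f.coneIdeal (0 : σ → K)
  set m := pointIdeal (0 : σ → K)
  have h2 : m ≤ Q ⊔ m ^ 2 := by
    rw [show m = _ from pointIdeal_zero_eq_idealOfVars]
    conv_lhs => rw [idealOfVars]
    rw [Ideal.span_le]
    rintro _ ⟨i, rfl⟩
    have h3 : f.coord i ∈ idealOfVars σ K ^ 2 := by
      rw [mem_pow_idealOfVars_iff]
      intro x hx
      have : d = x.degree := (f.homog i).degree_eq_sum_deg_support hx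
      omega
    have h4 : f.coord i - X i ∈ Q := le_localSat _ _ (Ideal.subset_span ⟨i, rfl⟩)
    have := Ideal.sub_mem _ (Ideal.mem_sup_right (S := Q) h3) (Ideal.mem_sup_left h4)
    simpa using this
  have h3 : ∀ n, m ≤ Q ⊔ m ^ (n + 1) := by
    intro n
    induction n with
    | zero => simp
    | succ n ih =>
      refine h2.trans (sup_le le_sup_left ?_)
      calc m ^ 2 = m * m := sq m
        _ ≤ m * (Q ⊔ m ^ (n + 1)) := Ideal.mul_mono_right ih
        _ = m * Q ⊔ m ^ (n + 1 + 1) := by rw [Ideal.mul_sup, ← pow_succ']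
        _ ≤ _ := sup_le_sup_right Ideal.mul_le_right _
  exact (h3 k).trans (sup_le le_rfl ((Ideal.pow_le_pow_right (Nat.le_succ k)).trans hk))

end Cone

/-! ### Multiplicities on the cone over a projective fixed point -/

section ConeCover

open MvPolynomial

variable {K : Type*} [Field K] {σ : Type*} {d : ℕ}

theorem X_sub_one_mem_fixedIdeal (f : ProjEndo K σ d) (j : σ) : X j - 1 ∈ f.fixedIdeal j :=
  Ideal.subset_span (Or.inl rfl)

theorem minor_mem_fixedIdeal (f : ProjEndo K σ d) (j v w : σ) :
    X v * f.coord w - X w * f.coord v ∈ f.fixedIdeal j :=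
  Ideal.subset_span (Or.inr ⟨v, w, rfl⟩)

theorem coord_sub_mem_fixedIdeal (f : ProjEndo K σ d) (j i : σ) :
    f.coord i - X i * f.coord j ∈ f.fixedIdeal j := by
  have h := Ideal.sub_mem _ (f.minor_mem_fixedIdeal j j i)
    (Ideal.mul_mem_right (f.coord i) _ (f.X_sub_one_mem_fixedIdeal j))
  convert h using 1
  ring

theorem fixedIdeal_le_ker {A : Type*} [CommRing A] [Algebra K A] (f : ProjEndo K σ d) (j : σ)
    (φ : MvPolynomial σ K →ₐ[K] A) (h1 : φ (X j) = 1)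
    (h2 : ∀ v w, φ (X v) * φ (f.coord w) = φ (X w) * φ (f.coord v)) :
    f.fixedIdeal j ≤ RingHom.ker φ := by
  rw [fixedIdeal, Ideal.span_le]
  rintro _ (rfl | ⟨v, w, rfl⟩)
  · simp [RingHom.mem_ker, h1]
  · simp [RingHom.mem_ker, h2 v w]

theorem fixedIdeal_le_pointIdeal {f : ProjEndo K σ d} {j : σ} {p : σ → K} :
    f.fixedIdeal j ≤ pointIdeal p ↔
      p j = 1 ∧ ∀ i, eval p (f.coord i) = p i * eval p (f.coord j) := by
  constructor
  · intro h
    have h1 := h (f.X_sub_one_mem_fixedIdeal j)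
    refine ⟨by simpa [RingHom.mem_ker, sub_eq_zero] using h1, fun i => ?_⟩
    have h2 := h (f.coord_sub_mem_fixedIdeal j i)
    simpa [RingHom.mem_ker, sub_eq_zero] using h2
  · rintro ⟨h1, h2⟩
    refine f.fixedIdeal_le_ker j (aeval p) (by simpa using h1) fun v w => ?_
    simp only [aeval_eq_eval, eval_X]
    rw [h2 v, h2 w]
    ring

theorem eval_coord_ne_zero {f : ProjEndo K σ d} {j : σ} {p : σ → K}
    (h : f.fixedIdeal j ≤ pointIdeal p) : eval p (f.coord j) ≠ 0 := by
  obtain ⟨h1, h2⟩ := fixedIdeal_le_pointIdeal.mp h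
  intro h0
  obtain ⟨i, hi⟩ := f.no_common_zero p fun h => by simp [h] at h1
  exact hi (by rw [h2 i, h0, mul_zero])

/-- The cone over the local ring of the fixed point scheme at `p`: the algebra obtained by
adjoining a `(d - 1)`-st root of the inverse `t` of the coordinate `j`. -/
abbrev ConeCover (f : ProjEndo K σ d) (j : σ) (p : σ → K) (t : MvPolynomial σ K) : Type _ :=
  AdjoinRoot (Polynomial.X ^ (d - 1) -
    Polynomial.C (Ideal.Quotient.mk (localSat (f.fixedIdeal j) p) t))

/-- The parametrization `x ↦ s x` of the cone. -/
noncomputable def coneCoverHom (f : ProjEndo K σ d) (j : σ) (p : σ → K) (t : MvPolynomial σ K) :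
    MvPolynomial σ K →ₐ[K] ConeCover f j p t :=
  aeval fun i => AdjoinRoot.root _ * AdjoinRoot.of _ (Ideal.Quotient.mk _ (X i))

variable {f : ProjEndo K σ d} {j : σ} {p : σ → K} {t : MvPolynomial σ K}

theorem of_mk_eq_aeval (r : MvPolynomial σ K) :
    (AdjoinRoot.of (Polynomial.X ^ (d - 1) -
      Polynomial.C (Ideal.Quotient.mk (localSat (f.fixedIdeal j) p) t))
        (Ideal.Quotient.mk _ r) : ConeCover f j p t) =
      aeval (fun i => (AdjoinRoot.of _ (Ideal.Quotient.mk _ (X i)) : ConeCover f j p t)) r := by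
  let φ : MvPolynomial σ K →ₐ[K] ConeCover f j p t :=
    (IsScalarTower.toAlgHom K (MvPolynomial σ K ⧸ localSat (f.fixedIdeal j) p)
      (ConeCover f j p t)).comp (Ideal.Quotient.mkₐ K _)
  exact DFunLike.congr_fun (aeval_unique φ) r

theorem coneCoverHom_apply_of_isHomogeneous {F : MvPolynomial σ K} {e : ℕ}
    (hF : F.IsHomogeneous e) :
    coneCoverHom f j p t F =
      AdjoinRoot.root _ ^ e * AdjoinRoot.of _ (Ideal.Quotient.mk _ F) := by
  rw [coneCoverHom, aeval_mul_of_isHomogeneous hF, of_mk_eq_aeval]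

theorem root_pow : (AdjoinRoot.root _ : ConeCover f j p t) ^ (d - 1) =
    AdjoinRoot.of _ (Ideal.Quotient.mk _ t) := by
  have := AdjoinRoot.eval₂_root (Polynomial.X ^ (d - 1) -
    Polynomial.C (Ideal.Quotient.mk (localSat (f.fixedIdeal j) p) t))
  simpa [sub_eq_zero] using this

theorem root_pow_mul_of_coord (ht : f.coord j * t - 1 ∈ localSat (f.fixedIdeal j) p) :
    (AdjoinRoot.root _ : ConeCover f j p t) ^ (d - 1) *
      AdjoinRoot.of _ (Ideal.Quotient.mk _ (f.coord j)) = 1 := by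
  rw [root_pow, ← map_mul, ← map_mul, mul_comm, ← map_one (AdjoinRoot.of _),
    ← map_one (Ideal.Quotient.mk _)]
  exact congrArg _ (Ideal.Quotient.eq.mpr ht)

theorem isUnit_root (hd : 2 ≤ d) (ht : f.coord j * t - 1 ∈ localSat (f.fixedIdeal j) p) :
    IsUnit (AdjoinRoot.root _ : ConeCover f j p t) :=
  (isUnit_pow_iff (by omega)).mp (IsUnit.of_mul_eq_one _ (root_pow_mul_of_coord ht))

theorem coneCoverHom_X_chart : coneCoverHom f j p t (X j) = AdjoinRoot.root _ := by
  rw [coneCoverHom, aeval_X]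
  have : Ideal.Quotient.mk (localSat (f.fixedIdeal j) p) (X j) = 1 := by
    rw [← map_one (Ideal.Quotient.mk _)]
    exact Ideal.Quotient.eq.mpr (le_localSat _ _ (f.X_sub_one_mem_fixedIdeal j))
  rw [this, map_one, mul_one]

/-- On the fixed point scheme `f_i = x_i f_j`, and `s ^ (d - 1) f_j = 1`, so `f_i(s x) = s ^ d x_i
f_j = s x_i`. -/
theorem coneIdeal_le_ker_coneCoverHom (hd : 2 ≤ d)
    (ht : f.coord j * t - 1 ∈ localSat (f.fixedIdeal j) p) :
    f.coneIdeal ≤ RingHom.ker (coneCoverHom f j p t) := by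
  rw [coneIdeal, Ideal.span_le]
  rintro _ ⟨i, rfl⟩
  have h1 : Ideal.Quotient.mk (localSat (f.fixedIdeal j) p) (f.coord i) =
      Ideal.Quotient.mk _ (X i) * Ideal.Quotient.mk _ (f.coord j) := by
    rw [← map_mul]
    exact Ideal.Quotient.eq.mpr (le_localSat _ _ (f.coord_sub_mem_fixedIdeal j i))
  rw [SetLike.mem_coe, RingHom.mem_ker, map_sub, coneCoverHom_apply_of_isHomogeneous (f.homog i),
    coneCoverHom_apply_of_isHomogeneous (isHomogeneous_X K i), h1, map_mul, pow_one]
  have h2 := root_pow_mul_of_coord ht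
  have h3 : (AdjoinRoot.root _ : ConeCover f j p t) ^ d =
      AdjoinRoot.root _ ^ (d - 1) * AdjoinRoot.root _ := by
    rw [← pow_succ, Nat.sub_add_cancel (by omega)]
  rw [h3]
  linear_combination (AdjoinRoot.root _ * AdjoinRoot.of _ (Ideal.Quotient.mk _ (X i))) * h2

/-- The image contains the root `s`, the image of `X j`. Being finite-dimensional over `K`, hence
Artinian, it also contains the inverse of the non-zero-divisor `s`, and so the `x_i = s⁻¹ (s x_i)`.
-/
theorem coneCoverHom_surjective [Module.Finite K (MvPolynomial σ K ⧸ localSat (f.fixedIdeal j) p)]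
    (hd : 2 ≤ d) (ht : f.coord j * t - 1 ∈ localSat (f.fixedIdeal j) p) :
    Function.Surjective (coneCoverHom f j p t) := by
  have : Module.Finite (MvPolynomial σ K ⧸ localSat (f.fixedIdeal j) p) (ConeCover f j p t) :=
    (Polynomial.monic_X_pow_sub_C _ (by omega)).finite_adjoinRoot
  have : Module.Finite K (ConeCover f j p t) :=
    Module.Finite.trans (MvPolynomial σ K ⧸ localSat (f.fixedIdeal j) p) _
  let A := (coneCoverHom f j p t).range
  have : IsArtinianRing A := IsArtinianRing.of_finite K _
  have hroot : AdjoinRoot.root _ ∈ A := ⟨X j, coneCoverHom_X_chart⟩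
  obtain ⟨b, hb⟩ : ∃ b ∈ A, AdjoinRoot.root _ * b = 1 := by
    have h1 : IsUnit (⟨_, hroot⟩ : A) := by
      apply IsArtinianRing.isUnit_of_mem_nonZeroDivisors
      rw [mem_nonZeroDivisors_iff_right]
      intro x hx
      have h2 := congrArg Subtype.val hx
      exact Subtype.ext ((isUnit_root hd ht).mul_left_eq_zero.mp h2)
    obtain ⟨b, hb⟩ := h1.exists_right_inv
    exact ⟨b, b.2, congrArg Subtype.val hb⟩
  have hof : ∀ r, AdjoinRoot.of _ (Ideal.Quotient.mk _ r) ∈ A := by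
    intro r
    rw [of_mk_eq_aeval]
    induction r using MvPolynomial.induction_on with
    | C a => rw [← algebraMap_eq, AlgHom.commutes]; exact A.algebraMap_mem a
    | add q r hp hq => rw [map_add]; exact A.add_mem hp hq
    | mul_X q i hp =>
      rw [map_mul, aeval_X]
      refine A.mul_mem hp ?_
      have h3 : coneCoverHom f j p t (X i) * b ∈ A := A.mul_mem ⟨_, rfl⟩ hb.1
      rw [coneCoverHom, aeval_X, mul_right_comm, hb.2, one_mul] at h3
      exact h3
  rw [← AlgHom.range_eq_top, eq_top_iff]
  rintro x -
  obtain ⟨q, rfl⟩ := AdjoinRoot.mk_surjective x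
  induction q using Polynomial.induction_on' with
  | add q r hp hq => rw [map_add]; exact A.add_mem hp hq
  | monomial n a =>
    obtain ⟨r, rfl⟩ := Ideal.Quotient.mk_surjective a
    rw [← Polynomial.C_mul_X_pow_eq_monomial, map_mul, map_pow, AdjoinRoot.mk_C, AdjoinRoot.mk_X]
    exact A.mul_mem (hof r) (A.pow_mem hroot n)

theorem finrank_quotient_ker_coneCoverHom
    [Module.Finite K (MvPolynomial σ K ⧸ localSat (f.fixedIdeal j) p)]
    (hp : f.fixedIdeal j ≤ pointIdeal p)
    (hd : 2 ≤ d) (ht : f.coord j * t - 1 ∈ localSat (f.fixedIdeal j) p) :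
    Module.Finite K (MvPolynomial σ K ⧸ RingHom.ker (coneCoverHom f j p t)) ∧
    Module.finrank K (MvPolynomial σ K ⧸ RingHom.ker (coneCoverHom f j p t)) =
      (d - 1) * Module.finrank K (MvPolynomial σ K ⧸ localSat (f.fixedIdeal j) p) := by
  have : Nontrivial (MvPolynomial σ K ⧸ localSat (f.fixedIdeal j) p) := by
    refine Ideal.Quotient.nontrivial_iff.mpr fun h => ?_
    have h1 : (1 : MvPolynomial σ K) ∈ localSat (f.fixedIdeal j) p := h ▸ trivial
    simpa using eval_eq_zero_of_mem_localSat hp h1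
  have hmonic := Polynomial.monic_X_pow_sub_C
    (Ideal.Quotient.mk (localSat (f.fixedIdeal j) p) t) (show d - 1 ≠ 0 by omega)
  have : Module.Finite (MvPolynomial σ K ⧸ localSat (f.fixedIdeal j) p) (ConeCover f j p t) :=
    hmonic.finite_adjoinRoot
  have : Module.Free (MvPolynomial σ K ⧸ localSat (f.fixedIdeal j) p) (ConeCover f j p t) :=
    hmonic.free_adjoinRoot
  have : Module.Finite K (ConeCover f j p t) :=
    Module.Finite.trans (MvPolynomial σ K ⧸ localSat (f.fixedIdeal j) p) _
  have e := (Ideal.quotientKerAlgEquivOfSurjective (coneCoverHom_surjective hd ht)).toLinearEquiv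
  refine ⟨Module.Finite.equiv e.symm, ?_⟩
  have h1 := e.finrank_eq
  rw [← Module.finrank_mul_finrank K (MvPolynomial σ K ⧸ localSat (f.fixedIdeal j) p)
    (ConeCover f j p t), PowerBasis.finrank (AdjoinRoot.powerBasis' hmonic),
    AdjoinRoot.powerBasis'_dim, Polynomial.natDegree_X_pow_sub_C, mul_comm] at h1
  exact h1

theorem eq_smul_of_ker_coneCoverHom_le {k : ℕ} (hk : pointIdeal p ^ k ≤ localSat (f.fixedIdeal j) p)
    [Module.Finite K (MvPolynomial σ K ⧸ localSat (f.fixedIdeal j) p)]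
    (hd : 2 ≤ d) (ht : f.coord j * t - 1 ∈ localSat (f.fixedIdeal j) p) {v : σ → K}
    (hv : RingHom.ker (coneCoverHom f j p t) ≤ pointIdeal v) : v j ≠ 0 ∧ v = v j • p := by
  constructor
  · obtain ⟨a, ha⟩ := (isUnit_root hd ht).exists_right_inv
    obtain ⟨b, rfl⟩ := coneCoverHom_surjective hd ht a
    have h1 : X j * b - 1 ∈ RingHom.ker (coneCoverHom f j p t) := by
      rw [RingHom.mem_ker, map_sub, map_mul, coneCoverHom_X_chart, ha, map_one, sub_self]
    have h2 := hv h1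
    intro h0
    simp [RingHom.mem_ker, h0] at h2
  · funext i
    -- The image of this power is `s ^ k (x_i - p_i) ^ k`, and `k` is chosen so that `(x_i - p_i) ^
    -- k` vanishes in the local ring.
    have h1 : (X i - C (p i) * X j) ^ k ∈ RingHom.ker (coneCoverHom f j p t) := by
      have h2 : (X i - C (p i)) ^ k ∈ localSat (f.fixedIdeal j) p :=
        hk (Ideal.pow_mem_pow (by simp [RingHom.mem_ker]) k)
      have h3 := Ideal.Quotient.eq_zero_iff_mem.mpr h2
      have h4 : coneCoverHom f j p t (X i - C (p i) * X j) =
          AdjoinRoot.root _ * AdjoinRoot.of _ (Ideal.Quotient.mk _ (X i - C (p i))) := by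
        rw [of_mk_eq_aeval, map_sub, map_sub, map_mul, coneCoverHom_X_chart, mul_sub, coneCoverHom,
          aeval_X, aeval_X, ← algebraMap_eq, AlgHom.commutes, AlgHom.commutes,
          mul_comm (AdjoinRoot.root _) (algebraMap _ _ _)]
      rw [RingHom.mem_ker, map_pow, h4, mul_pow, ← map_pow, ← map_pow, h3, map_zero, mul_zero]
    have h2 := hv h1
    rw [RingHom.mem_ker, map_pow] at h2
    have h3 : eval v (X i - C (p i) * X j) = 0 := by
      by_contra h0
      exact pow_ne_zero k h0 h2
    rw [Pi.smul_apply, smul_eq_mul, mul_comm]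
    simpa [sub_eq_zero] using h3

/-- The quotient map to the local ring of the cone scheme at `v` factors through `ConeCover`. Since
`X j` is invertible there, dehomogenizing by `x_i = X i / X j` maps the local ring at `p` to it, and
`s ↦ X j` extends this map to the cover. -/
theorem ker_coneCoverHom_le_localSat (hd : 2 ≤ d)
    (ht : f.coord j * t - 1 ∈ localSat (f.fixedIdeal j) p) {v : σ → K} (hvj : v j ≠ 0)
    (hvp : v = v j • p) (hv : f.coneIdeal ≤ pointIdeal v) {k : ℕ}
    (hk : pointIdeal v ^ k ≤ localSat f.coneIdeal v) :
    RingHom.ker (coneCoverHom f j p t) ≤ localSat f.coneIdeal v := by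
  obtain ⟨a, ha⟩ := exists_mul_sub_one_mem hk (s := X j) (by simpa using hvj)
  set Q := localSat f.coneIdeal v
  let π := Ideal.Quotient.mkₐ K Q
  have hπ : ∀ r s, π r = π s ↔ r - s ∈ Q := fun r s => Ideal.Quotient.eq
  have hπ0 : ∀ r, π r = 0 ↔ r ∈ Q := fun r => Ideal.Quotient.eq_zero_iff_mem
  have ha' : π (X j) * π a = 1 := by
    rw [← map_mul, ← map_one π]
    exact (hπ _ _).mpr ha
  have hF : ∀ i, π (f.coord i) = π (X i) := fun i =>
    (hπ _ _).mpr (le_localSat _ _ (Ideal.subset_span ⟨i, rfl⟩))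
  let ψ : MvPolynomial σ K →ₐ[K] MvPolynomial σ K ⧸ Q := aeval fun i => π a * π (X i)
  have hψX : ∀ i, ψ (X i) = π a * π (X i) := fun i => aeval_X _ _
  have hψF : ∀ i, ψ (f.coord i) = π a ^ d * π (X i) := fun i => by
    rw [← hF i, show ψ (f.coord i) = _ from aeval_mul_of_isHomogeneous (f.homog i) (π a) _]
    exact congrArg _ (DFunLike.congr_fun (aeval_unique π) _).symm
  let ev : (MvPolynomial σ K ⧸ Q) →ₐ[K] K := Ideal.Quotient.liftₐ Q (aeval v) fun r hr => by
    rw [aeval_eq_eval]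
    exact eval_eq_zero_of_mem_localSat hv hr
  have hev : ∀ r, ev (π r) = eval v r := fun r => by
    change aeval v r = _
    rw [aeval_eq_eval]
  have heva : ev (π a) = (v j)⁻¹ := by
    have := congrArg ev ha'
    rw [map_mul, hev, eval_X, map_one] at this
    exact eq_inv_of_mul_eq_one_right this
  have hevψ : ∀ r, ev (ψ r) = eval p r := by
    have : ev.comp ψ = aeval p := by
      ext i
      rw [AlgHom.comp_apply, hψX, map_mul, heva, hev, eval_X, aeval_X]
      have hvi : v i = v j * p i := congrFun hvp i
      rw [hvi, inv_mul_cancel_left₀ hvj]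
    intro r
    rw [← AlgHom.comp_apply, this, aeval_eq_eval]
  have hψ1 : f.fixedIdeal j ≤ RingHom.ker ψ := by
    refine f.fixedIdeal_le_ker j ψ (by rw [hψX, mul_comm, ha']) fun x y => ?_
    rw [hψX, hψX, hψF, hψF]
    ring
  have hψQ : ∀ r ∈ localSat (f.fixedIdeal j) p, ψ r = 0 := by
    rintro r ⟨s, hs, hsr⟩
    have h1 := hψ1 hsr
    rw [RingHom.mem_ker, map_mul] at h1
    obtain ⟨s', hs'⟩ := Ideal.Quotient.mk_surjective (ψ s)
    have h2 : eval v s' ≠ 0 := by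
      rw [← hev, show π s' = ψ s from hs', hevψ]
      exact hs
    obtain ⟨b, hb⟩ := exists_mul_sub_one_mem hk h2
    have h3 : ψ s * π b = 1 := by
      rw [← hs', ← map_one π]
      exact (hπ (s' * b) 1).mpr hb
    calc ψ r = (ψ s * π b) * ψ r := by rw [h3, one_mul]
      _ = (ψ s * ψ r) * π b := by ring
      _ = 0 := by rw [h1, zero_mul]
  let ψ' : (MvPolynomial σ K ⧸ localSat (f.fixedIdeal j) p) →+* MvPolynomial σ K ⧸ Q :=
    Ideal.Quotient.lift _ (ψ : MvPolynomial σ K →+* _) hψQ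
  have hψ' : ∀ r, ψ' (Ideal.Quotient.mk _ r) = ψ r := fun r => rfl
  -- The extension to the root requires `t ↦ X j ^ (d - 1)`. This holds because `f_j` maps to `X j ^
  -- (1 - d)`.
  have ht' : ψ t = π (X j) ^ (d - 1) := by
    have h1 := hψQ _ ht
    rw [map_sub, map_mul, map_one, sub_eq_zero, hψF, ← Nat.sub_add_cancel (show 1 ≤ d by omega),
      pow_succ, mul_assoc (π a ^ _), mul_comm (π a), ha', mul_one] at h1
    calc ψ t = (π (X j) * π a) ^ (d - 1) * ψ t := by rw [ha', one_pow, one_mul]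
      _ = π (X j) ^ (d - 1) * (π a ^ (d - 1) * ψ t) := by rw [mul_pow, mul_assoc]
      _ = _ := by rw [h1, mul_one]
  let χ : ConeCover f j p t →+* MvPolynomial σ K ⧸ Q := AdjoinRoot.lift ψ' (π (X j)) (by
    rw [Polynomial.eval₂_sub, Polynomial.eval₂_X_pow, Polynomial.eval₂_C, hψ', ht', sub_self])
  have hχ : χ.comp (coneCoverHom f j p t : MvPolynomial σ K →+* _) = π := by
    refine MvPolynomial.ringHom_ext (fun r => ?_) fun i => ?_
    · have h1 : coneCoverHom f j p t (C r) = AdjoinRoot.of _ (Ideal.Quotient.mk _ (C r)) := by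
        rw [coneCoverHom_apply_of_isHomogeneous (isHomogeneous_C σ r), pow_zero, one_mul]
      rw [RingHom.comp_apply, RingHom.coe_coe, h1, AdjoinRoot.lift_of, hψ', ← algebraMap_eq,
        AlgHom.commutes, RingHom.coe_coe, AlgHom.commutes]
    · rw [RingHom.comp_apply, RingHom.coe_coe, coneCoverHom, aeval_X, map_mul,
        AdjoinRoot.lift_root, AdjoinRoot.lift_of, hψ', hψX, ← mul_assoc, ha', one_mul]
      rfl
  intro r hr
  rw [RingHom.mem_ker] at hr
  rw [← hπ0]
  have := RingHom.congr_fun hχ r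
  rw [RingHom.comp_apply, RingHom.coe_coe, hr, map_zero] at this
  exact this.symm

variable [IsAlgClosed K]

theorem exists_coneIdeal_le_pointIdeal (f : ProjEndo K σ d) (hd : 2 ≤ d) {j : σ} {p : σ → K}
    (hp : f.fixedIdeal j ≤ pointIdeal p) :
    ∃ s : K, s ≠ 0 ∧ f.coneIdeal ≤ pointIdeal (s • p) := by
  obtain ⟨h1, h2⟩ := fixedIdeal_le_pointIdeal.mp hp
  have h3 := eval_coord_ne_zero hp
  obtain ⟨s, hs⟩ := IsAlgClosed.exists_pow_nat_eq (eval p (f.coord j))⁻¹ (n := d - 1) (by omega)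
  have hs0 : s ≠ 0 := by
    rintro rfl
    rw [zero_pow (by omega)] at hs
    exact inv_ne_zero h3 hs.symm
  refine ⟨s, hs0, coneIdeal_le_pointIdeal.mpr fun i => ?_⟩
  have h4 : s ^ d = s ^ (d - 1) * s := by rw [← pow_succ, Nat.sub_add_cancel (by omega)]
  rw [eval_smul_coord, h2 i, h4, hs, Pi.smul_apply, smul_eq_mul]
  field_simp

variable [Fintype σ]

theorem finite_quotient_fixedIdeal (f : ProjEndo K σ d) (hd : 2 ≤ d) (j : σ) :
    Module.Finite K (MvPolynomial σ K ⧸ f.fixedIdeal j) := by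
  have := f.finite_quotient_coneIdeal hd
  refine finite_quotient_of_finite_zeros
    (((finite_zeros f.coneIdeal).image fun v => (v j)⁻¹ • v).subset fun p hp => ?_)
  obtain ⟨s, hs0, hs⟩ := f.exists_coneIdeal_le_pointIdeal hd hp
  refine ⟨s • p, hs, ?_⟩
  simp only [Pi.smul_apply, smul_eq_mul, (fixedIdeal_le_pointIdeal.mp hp).1, mul_one]
  rw [smul_smul, inv_mul_cancel₀ hs0, one_smul]

/-- The kernel of `coneCoverHom` cuts out the part of the cone scheme on the line through `p`: it
agrees with the cone ideal locally at each such `v` and has no other zeros. The cover is free of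
rank `d - 1`, which gives the total length even when the characteristic divides `d - 1` and the
roots collide. -/
theorem sum_localMult_coneIdeal (f : ProjEndo K σ d) (hd : 2 ≤ d) {j : σ} {p : σ → K}
    (hp : f.fixedIdeal j ≤ pointIdeal p) {S : Finset (σ → K)}
    (hS : ∀ v, v ∈ S ↔ f.coneIdeal ≤ pointIdeal v ∧ v j ≠ 0 ∧ v = v j • p) :
    ∑ v ∈ S, localMult f.coneIdeal v = (d - 1) * localMult (f.fixedIdeal j) p := by
  have := f.finite_quotient_coneIdeal hd
  have := f.finite_quotient_fixedIdeal hd j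
  have : Module.Finite K (MvPolynomial σ K ⧸ localSat (f.fixedIdeal j) p) :=
    Module.Finite.of_surjective
      (Ideal.Quotient.factorₐ K (le_localSat (f.fixedIdeal j) p)).toLinearMap
      (Ideal.Quotient.factor_surjective (le_localSat (f.fixedIdeal j) p))
  obtain ⟨k, hk⟩ := exists_pow_le_localSat (f.fixedIdeal j) p
  obtain ⟨t, ht⟩ := exists_mul_sub_one_mem hk (eval_coord_ne_zero hp)
  obtain ⟨hfin, hrank⟩ := finrank_quotient_ker_coneCoverHom hp hd ht
  have hle := coneIdeal_le_ker_coneCoverHom hd ht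
  rw [localMult_eq_finrank hk, ← hrank, finrank_quotient_eq_sum_localMult _ (S := S) fun v hv =>
    (hS v).mpr ⟨hle.trans hv, eq_smul_of_ker_coneCoverHom_le hk hd ht hv⟩]
  refine Finset.sum_congr rfl fun v hv => ?_
  obtain ⟨h1, h2, h3⟩ := (hS v).mp hv
  obtain ⟨k', hk'⟩ := exists_pow_le_localSat f.coneIdeal v
  exact localMult_congr (le_antisymm (localSat_mono hle v)
    (localSat_le_of_le (ker_coneCoverHom_le_localSat hd ht h2 h3 h1 hk'))) hk'

end ConeCover

/-! ### Multiplicities on product schemes -/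

section ProductMultiplicity

open MvPolynomial
open scoped TensorProduct

variable {K : Type*} [Field K] {κ σ τ : Type*}

/-- The ideal of the product of the subschemes `V (I j)`, the coordinates of the ambient affine
space being divided into blocks along `e`. -/
noncomputable def blockIdeal (e : κ × σ ≃ τ) (I : κ → Ideal (MvPolynomial σ K)) :
    Ideal (MvPolynomial τ K) :=
  ⨆ j, (I j).map (rename fun k => e (j, k))

theorem map_rename_le_blockIdeal (e : κ × σ ≃ τ) (I : κ → Ideal (MvPolynomial σ K)) (j : κ) :
    (I j).map (rename fun k => e (j, k)) ≤ blockIdeal e I :=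
  le_iSup (fun j => (I j).map (rename fun k => e (j, k))) j

theorem blockIdeal_le_pointIdeal {e : κ × σ ≃ τ} {I : κ → Ideal (MvPolynomial σ K)} {p : τ → K} :
    blockIdeal e I ≤ pointIdeal p ↔ ∀ j, I j ≤ pointIdeal fun k => p (e (j, k)) := by
  rw [blockIdeal, iSup_le_iff]
  refine forall_congr' fun j => ?_
  rw [Ideal.map_le_iff_le_comap]
  refine forall_congr' fun r => imp_congr_right fun _ => ?_
  rw [Ideal.mem_comap, RingHom.mem_ker, RingHom.mem_ker, eval_rename]
  rfl

/-- The coordinate ring of a product is the tensor product of the coordinate rings. -/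
noncomputable def quotientBlockIdealEquiv [Fintype κ] (e : κ × σ ≃ τ)
    (I : κ → Ideal (MvPolynomial σ K)) :
    (MvPolynomial τ K ⧸ blockIdeal e I) ≃ₐ[K] ⨂[K] j, (MvPolynomial σ K ⧸ I j) := by
  classical
  let Φ : MvPolynomial τ K →ₐ[K] ⨂[K] j, (MvPolynomial σ K ⧸ I j) :=
    aeval fun t => PiTensorProduct.singleAlgHom (R := K) (A := fun j => MvPolynomial σ K ⧸ I j)
      (e.symm t).1 (Ideal.Quotient.mk _ (X (e.symm t).2))
  have hΦ : ∀ j, Φ.comp (rename fun k => e (j, k)) =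
      (PiTensorProduct.singleAlgHom (R := K) (A := fun j => MvPolynomial σ K ⧸ I j) j).comp
        (Ideal.Quotient.mkₐ K (I j)) := by
    intro j
    refine algHom_ext fun k => ?_
    rw [AlgHom.comp_apply, rename_X, aeval_X, e.symm_apply_apply]
    rfl
  have hΦI : ∀ r ∈ blockIdeal e I, Φ r = 0 := by
    suffices blockIdeal e I ≤ RingHom.ker Φ from fun r hr => this hr
    refine iSup_le fun j => Ideal.map_le_iff_le_comap.mpr fun r hr => ?_
    rw [Ideal.mem_comap, RingHom.mem_ker]
    have := DFunLike.congr_fun (hΦ j) r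
    rw [AlgHom.comp_apply] at this
    rw [this, AlgHom.comp_apply, Ideal.Quotient.mkₐ_eq_mk, Ideal.Quotient.eq_zero_iff_mem.mpr hr,
      map_zero]
  let φ : ∀ j, (MvPolynomial σ K ⧸ I j) →ₐ[K] MvPolynomial τ K ⧸ blockIdeal e I := fun j =>
    Ideal.quotientMapₐ _ (rename fun k => e (j, k))
      (Ideal.map_le_iff_le_comap.mp (map_rename_le_blockIdeal e I j))
  let Ψ : (⨂[K] j, (MvPolynomial σ K ⧸ I j)) →ₐ[K] MvPolynomial τ K ⧸ blockIdeal e I :=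
    PiTensorProduct.liftAlgHom
      ((MultilinearMap.mkPiAlgebra K κ _).compLinearMap fun j => (φ j).toLinearMap)
      (by simp) (fun x y => by simp [Finset.prod_mul_distrib])
  have hΨ : ∀ j, Ψ.comp (PiTensorProduct.singleAlgHom j) = φ j := by
    intro j
    refine AlgHom.ext fun x => ?_
    rw [AlgHom.comp_apply, PiTensorProduct.singleAlgHom_apply]
    change PiTensorProduct.lift ((MultilinearMap.mkPiAlgebra K κ _).compLinearMap
      fun j => (φ j).toLinearMap) (PiTensorProduct.tprod K _) = _
    rw [PiTensorProduct.lift.tprod, MultilinearMap.compLinearMap_apply,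
      MultilinearMap.mkPiAlgebra_apply, Finset.prod_eq_single j]
    · simp
    · intro i _ hi
      simp [hi]
    · simp
  refine AlgEquiv.ofAlgHom (Ideal.Quotient.liftₐ _ Φ hΦI) Ψ ?_ ?_
  · refine PiTensorProduct.algHom_ext fun j => ?_
    rw [AlgHom.comp_assoc, hΨ]
    refine Ideal.Quotient.algHom_ext _ ?_
    exact hΦ j
  · refine Ideal.Quotient.algHom_ext _ (algHom_ext fun t => ?_)
    change Ψ (Φ (X t)) = Ideal.Quotient.mk _ (X t)
    rw [aeval_X, ← AlgHom.comp_apply, hΨ]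
    change Ideal.Quotient.mk _ (rename _ (X _)) = _
    rw [rename_X, Prod.mk.eta, e.apply_symm_apply]

theorem finrank_piTensorProduct [Fintype κ] (V : κ → Type*) [∀ j, AddCommGroup (V j)]
    [∀ j, Module K (V j)] [∀ j, Module.Finite K (V j)] :
    Module.finrank K (⨂[K] j, V j) = ∏ j, Module.finrank K (V j) := by
  classical
  rw [Module.finrank_eq_card_basis (Basis.piTensorProduct fun j => Module.finBasis K (V j)),
    Fintype.card_pi]
  simp

/-- Saturating each factor saturates the product, and the quotient by the result is the tensor
product of the local rings. -/
theorem localMult_blockIdeal [Fintype κ] [Finite σ] [Finite τ] [IsAlgClosed K] (e : κ × σ ≃ τ)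
    (I : κ → Ideal (MvPolynomial σ K)) [∀ j, Module.Finite K (MvPolynomial σ K ⧸ I j)]
    (p : τ → K) :
    localMult (blockIdeal e I) p = ∏ j, localMult (I j) fun k => p (e (j, k)) := by
  have hex := fun j => exists_pow_le_localSat (I j) fun k => p (e (j, k))
  choose k hk using hex
  let Q : κ → Ideal (MvPolynomial σ K) := fun j => localSat (I j) fun k => p (e (j, k))
  have hfin : ∀ j, Module.Finite K (MvPolynomial σ K ⧸ Q j) := fun j =>
    Module.Finite.of_surjective (Ideal.Quotient.factorₐ K (le_localSat (I j) _)).toLinearMap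
      (Ideal.Quotient.factor_surjective (le_localSat (I j) _))
  have hIQ : blockIdeal e I ≤ blockIdeal e Q :=
    iSup_mono fun j => Ideal.map_mono (le_localSat _ _)
  -- The only possible zero of `blockIdeal e Q` is `p`, because each `Q j` contains a power of the
  -- maximal ideal of its point; the Nullstellensatz then applies.
  obtain ⟨n, hn⟩ : ∃ n, pointIdeal p ^ n ≤ blockIdeal e Q := by
    refine Ideal.exists_pow_le_of_le_radical_of_fg ?_ (IsNoetherian.noetherian _)
    rw [← vanishingIdeal_zeroLocus_eq_radical (K := K)]
    intro r hr v hv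
    have hvQ : blockIdeal e Q ≤ pointIdeal v := fun s hs => by
      simpa [RingHom.mem_ker, aeval_eq_eval] using hv s hs
    have hvp : v = p := by
      funext t
      obtain ⟨⟨j, i⟩, rfl⟩ := e.surjective t
      have h1 : (X i - C (p (e (j, i)))) ^ k j ∈ Q j :=
        hk j (Ideal.pow_mem_pow (by simp [RingHom.mem_ker]) _)
      have h2 := blockIdeal_le_pointIdeal.mp hvQ j h1
      rw [RingHom.mem_ker, map_pow] at h2
      have h3 : eval (fun k => v (e (j, k))) (X i - C (p (e (j, i)))) = 0 := by
        by_contra h0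
        exact pow_ne_zero _ h0 h2
      simpa [sub_eq_zero] using h3
    rw [hvp, aeval_eq_eval]
    exact hr
  have hsat : localSat (blockIdeal e I) p = blockIdeal e Q := by
    refine le_antisymm (localSat_le_of_pow_le hIQ hn) ?_
    refine iSup_le fun j => Ideal.map_le_iff_le_comap.mpr ?_
    rintro r ⟨s, hs, hsr⟩
    refine ⟨rename (fun k => e (j, k)) s, by rwa [eval_rename], ?_⟩
    have := map_rename_le_blockIdeal e I j (Ideal.mem_map_of_mem _ hsr)
    rwa [map_mul] at this
  rw [localMult_eq_finrank (hsat ▸ hn), hsat,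
    (quotientBlockIdealEquiv e Q).toLinearEquiv.finrank_eq, finrank_piTensorProduct]
  exact Finset.prod_congr rfl fun j _ => (localMult_eq_finrank (hk j)).symm

end ProductMultiplicity

/-! ### Differentials of the homogeneous lift -/

section ConeMultiplier

open MvPolynomial

variable {K : Type*} [Field K] {κ σ τ : Type*} {d : ℕ}

/-- The Jacobian matrix of the homogeneous lift of `f`. -/
noncomputable def coneJacobian (f : ProjEndo K σ d) (v : σ → K) : Matrix σ σ K :=
  Matrix.of fun i k => eval v (pderiv k (f.coord i))

open Classical in
/-- The characteristic polynomial of the differential of the homogeneous lift of `f`. -/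
noncomputable def conePoly [Fintype σ] (f : ProjEndo K σ d) (v : σ → K) : Polynomial K :=
  (f.coneJacobian v).charpoly

theorem coneJacobian_smul (f : ProjEndo K σ d) (c : K) (v : σ → K) :
    f.coneJacobian (c • v) = c ^ (d - 1) • f.coneJacobian v := by
  ext i k
  exact eval_smul_of_isHomogeneous (f.homog i).pderiv c v

theorem coneJacobian_mulVec [Fintype σ] (f : ProjEndo K σ d) (v : σ → K) (i : σ) :
    ∑ k, f.coneJacobian v i k * v k = d * eval v (f.coord i) := by
  have := congrArg (eval v) (f.homog i).sum_X_mul_pderiv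
  rw [map_sum, nsmul_eq_mul, map_mul, map_natCast] at this
  rw [← this]
  refine Finset.sum_congr rfl fun k _ => ?_
  rw [map_mul, eval_X, mul_comm]
  rfl

/-- The hypotheses say that the columns of `(P, 1)` span an invariant subspace on which the matrix
acts by `E`. A unipotent conjugation makes it block triangular, with `A - P * C` acting on the
quotient. -/
theorem charpoly_fromBlocks_of_eigenvector {R m n : Type*} [CommRing R] [Fintype m] [DecidableEq m]
    [Fintype n] [DecidableEq n] (A : Matrix m m R) (B : Matrix m n R) (C : Matrix n m R)
    (D : Matrix n n R) (P : Matrix m n R) (E : Matrix n n R) (h1 : A * P + B = P * E)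
    (h2 : C * P + D = E) :
    (Matrix.fromBlocks A B C D).charpoly = (A - P * C).charpoly * E.charpoly := by
  have h3 : Matrix.fromBlocks A B C D =
      (Matrix.fromBlocks A B C D * Matrix.fromBlocks 1 P 0 1) * Matrix.fromBlocks 1 (-P) 0 1 := by
    rw [Matrix.mul_assoc, Matrix.fromBlocks_multiply (1 : Matrix m m R)]
    simp
  have h4 : Matrix.fromBlocks 1 (-P) 0 1 *
      (Matrix.fromBlocks A B C D * Matrix.fromBlocks 1 P 0 1) =
      Matrix.fromBlocks (A - P * C) 0 C E := by
    rw [Matrix.fromBlocks_multiply, Matrix.fromBlocks_multiply]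
    simp [h1, h2, sub_eq_add_neg]
  rw [h3, Matrix.charpoly_mul_comm, h4, Matrix.charpoly_fromBlocks_zero₁₂]

-- By Euler's relation the fixed vector `s • p` is an eigenvector of the lift's differential with
-- eigenvalue `d`. The quotient by its line is the tangent space of projective space at the point,
-- with the differential of `f` acting on it.
open Classical in
theorem conePoly_eq_mul [Fintype σ] (f : ProjEndo K σ d) (hd : 2 ≤ d) {j : σ} {p : σ → K} {s : K}
    (hs : s ≠ 0) (hpj : p j = 1) (hv : f.coneIdeal ≤ pointIdeal (s • p)) :
    f.conePoly (s • p) =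
      (Polynomial.X - Polynomial.C (d : K)) * (f.jacobian j p).charpoly := by
  rw [coneIdeal_le_pointIdeal] at hv
  have hsd : s ^ d = s ^ (d - 1) * s := by rw [← pow_succ, Nat.sub_add_cancel (by omega)]
  have hF : ∀ i, s ^ (d - 1) * eval p (f.coord i) = p i := fun i => by
    have := hv i
    rw [eval_smul_coord, hsd, Pi.smul_apply, smul_eq_mul] at this
    exact mul_left_cancel₀ hs (by linear_combination this)
  have hFj : eval p (f.coord j) ≠ 0 := fun h => by
    have := hF j
    rw [h, hpj, mul_zero] at this
    exact zero_ne_one this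
  have hsF : s ^ (d - 1) = (eval p (f.coord j))⁻¹ := by
    have := hF j
    rw [hpj] at this
    exact eq_inv_of_mul_eq_one_left this
  let E := (Equiv.sumCompl fun i : σ => i ≠ j).symm
  let A := f.coneJacobian (s • p)
  have hA : ∀ i k, A i k = s ^ (d - 1) * eval p (pderiv k (f.coord i)) := fun i k =>
    eval_smul_of_isHomogeneous (f.homog i).pderiv s p
  have hAp : ∀ i, ∑ k, A i k * p k = d * p i := fun i => by
    have := f.coneJacobian_mulVec (s • p) i
    rw [hv i] at this
    refine mul_left_cancel₀ hs ?_
    rw [Finset.mul_sum]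
    calc _ = ∑ k, f.coneJacobian (s • p) i k * (s • p) k := Finset.sum_congr rfl fun k _ => by
            rw [Pi.smul_apply, smul_eq_mul]; ring
      _ = _ := by rw [this, Pi.smul_apply, smul_eq_mul]; ring
  let P : Matrix {i : σ // i ≠ j} {i : σ // ¬ i ≠ j} K := Matrix.of fun i _ => p i.1
  have hsum : ∀ i (k : {i : σ // ¬ i ≠ j}),
      ∑ l : {i : σ // i ≠ j}, A i l * p l + A i k = d * p i := fun i k => by
    have hk : k.1 = j := not_not.mp k.2
    rw [← hAp i, ← Equiv.sum_comp (Equiv.sumCompl fun i : σ => i ≠ j), Fintype.sum_sum_type]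
    congr 1
    rw [Fintype.sum_eq_single k fun l hl => absurd (Subtype.ext ((not_not.mp l.2).trans hk.symm)) hl]
    simp [hk, hpj]
  let A₁₁ : Matrix {i : σ // i ≠ j} {i : σ // i ≠ j} K := A.submatrix Subtype.val Subtype.val
  let A₁₂ : Matrix {i : σ // i ≠ j} {i : σ // ¬ i ≠ j} K := A.submatrix Subtype.val Subtype.val
  let A₂₁ : Matrix {i : σ // ¬ i ≠ j} {i : σ // i ≠ j} K := A.submatrix Subtype.val Subtype.val
  let A₂₂ : Matrix {i : σ // ¬ i ≠ j} {i : σ // ¬ i ≠ j} K := A.submatrix Subtype.val Subtype.val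
  have hblocks := charpoly_fromBlocks_of_eigenvector
    A₁₁ A₁₂ A₂₁ A₂₂ P
    ((d : K) • (1 : Matrix {i : σ // ¬ i ≠ j} {i : σ // ¬ i ≠ j} K))
    (by
      ext i k
      rw [Matrix.mul_smul, Matrix.mul_one]
      exact hsum i k)
    (by
      ext i k
      have hi : i.1 = j := not_not.mp i.2
      have hik : i = k := Subtype.ext (hi.trans (not_not.mp k.2).symm)
      rw [hik, Matrix.smul_apply, Matrix.one_apply_eq, smul_eq_mul]
      refine (hsum k k).trans ?_
      rw [← hik, hi, hpj, mul_one])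
  have h5 : Matrix.reindex E E A = Matrix.fromBlocks A₁₁ A₁₂ A₂₁ A₂₂ := by
    ext (i | i) (k | k) <;> rfl
  -- The quotient rule for `f_i / f_j`, simplified by `f_i(p) = p_i f_j(p)` and `s ^ (d - 1) = 1 /
  -- f_j(p)`.
  have h6 : A₁₁ - P * A₂₁ = f.jacobian j p := by
    ext i k
    rw [Matrix.sub_apply, Matrix.mul_apply, Fintype.sum_eq_single ⟨j, not_not.mpr rfl⟩
      fun l hl => absurd (Subtype.ext (not_not.mp l.2)) hl]
    change A i k - p i * A j k = (_ - _) / _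
    have hFi : eval p (f.coord i) = p i * eval p (f.coord j) := by
      rw [← hF i, hsF]
      field_simp
    rw [hA, hA, hsF, hFi]
    field_simp
  have h7 : ((d : K) • (1 : Matrix {i : σ // ¬ i ≠ j} {i : σ // ¬ i ≠ j} K)).charpoly =
      Polynomial.X - Polynomial.C (d : K) := by
    let : Unique {i : σ // ¬ i ≠ j} :=
      ⟨⟨⟨j, not_not.mpr rfl⟩⟩, fun i => Subtype.ext (not_not.mp i.2)⟩
    rw [Matrix.charpoly, Matrix.det_unique, Matrix.charmatrix_apply_eq, Matrix.smul_apply,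
      Matrix.one_apply_eq, smul_eq_mul, mul_one]
  rw [conePoly, ← Matrix.charpoly_reindex E, h5, hblocks, h6, h7, mul_comm]

theorem conePoly_zero [Fintype σ] (f : ProjEndo K σ d) (hd : 2 ≤ d) :
    f.conePoly 0 = Polynomial.X ^ Fintype.card σ := by
  have h : f.coneJacobian 0 = 0 := by
    have := f.coneJacobian_smul 0 0
    rwa [zero_smul, zero_pow (by omega), zero_smul] at this
  classical
  rw [conePoly, h, Matrix.charpoly_zero]

theorem charpoly_blockDiagonal {R m o : Type*} [CommRing R] [Fintype m] [DecidableEq m]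
    [Fintype o] [DecidableEq o] (M : o → Matrix m m R) :
    (Matrix.blockDiagonal M).charpoly = ∏ k, (M k).charpoly := by
  have h : (Matrix.blockDiagonal M).charmatrix = Matrix.blockDiagonal fun k => (M k).charmatrix := by
    ext ⟨i, k⟩ ⟨i', k'⟩
    by_cases hk : k = k'
    · subst hk
      by_cases hi : i = i'
      · subst hi
        simp [Matrix.blockDiagonal_apply]
      · simp [Matrix.blockDiagonal_apply, hi, Matrix.charmatrix_apply_ne]
    · simp [Matrix.blockDiagonal_apply, hk, Matrix.charmatrix_apply_ne]
  rw [Matrix.charpoly, h, Matrix.det_blockDiagonal]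
  rfl

/-- `g` acts by `f` on each of the blocks of coordinates given by `e`. -/
def IsBlockPower (e : κ × σ ≃ τ) (f : ProjEndo K σ d) (g : ProjEndo K τ d) : Prop :=
  ∀ q : κ × σ, g.coord (e q) = rename (fun k => e (q.1, k)) (f.coord q.2)

theorem IsBlockPower.coneIdeal_eq {e : κ × σ ≃ τ} {f : ProjEndo K σ d} {g : ProjEndo K τ d}
    (h : IsBlockPower e f g) : g.coneIdeal = blockIdeal e fun _ => f.coneIdeal := by
  refine le_antisymm ?_ (iSup_le fun j => ?_)
  · rw [coneIdeal, Ideal.span_le]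
    rintro _ ⟨t, rfl⟩
    obtain ⟨⟨j, i⟩, rfl⟩ := e.surjective t
    have := map_rename_le_blockIdeal e (fun _ => f.coneIdeal) j
      (Ideal.mem_map_of_mem _ (Ideal.subset_span ⟨i, rfl⟩))
    rwa [map_sub, rename_X, ← h (j, i)] at this
  · rw [coneIdeal, Ideal.map_span, Ideal.span_le]
    rintro _ ⟨_, ⟨i, rfl⟩, rfl⟩
    rw [map_sub, rename_X, ← h (j, i)]
    exact Ideal.subset_span ⟨e (j, i), rfl⟩

theorem IsBlockPower.conePoly_eq [Fintype κ] [Fintype σ] [Fintype τ] {e : κ × σ ≃ τ}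
    {f : ProjEndo K σ d} {g : ProjEndo K τ d} (h : IsBlockPower e f g) (z : τ → K) :
    g.conePoly z = ∏ j, f.conePoly fun k => z (e (j, k)) := by
  classical
  have h1 : Matrix.reindex ((Equiv.prodComm σ κ).trans e) ((Equiv.prodComm σ κ).trans e)
      (Matrix.blockDiagonal fun j => f.coneJacobian fun k => z (e (j, k))) = g.coneJacobian z := by
    ext t t'
    obtain ⟨⟨j, i⟩, rfl⟩ := e.surjective t
    obtain ⟨⟨j', i'⟩, rfl⟩ := e.surjective t'
    have hinj : Function.Injective fun k => e (j, k) := fun a b hab =>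
      (Prod.mk.inj (e.injective hab)).2
    rw [coneJacobian, Matrix.of_apply, h (j, i)]
    simp only [Matrix.reindex_apply, Matrix.submatrix_apply, Equiv.symm_trans_apply,
      Equiv.symm_apply_apply, Equiv.prodComm_symm, Equiv.prodComm_apply, Prod.swap_prod_mk,
      Matrix.blockDiagonal_apply]
    split_ifs with hj
    · subst hj
      rw [pderiv_rename hinj, eval_rename]
      rfl
    · rw [pderiv_eq_zero_of_notMem_vars, map_zero]
      intro hmem
      obtain ⟨k, -, hk⟩ := Finset.mem_image.mp (vars_rename _ _ hmem)
      exact hj (Prod.mk.inj (e.injective hk)).1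
  unfold conePoly
  rw [← h1, Matrix.charpoly_reindex, charpoly_blockDiagonal]

end ConeMultiplier

/-! ### Projective fixed points and their lifts -/

section FixedPoints

open MvPolynomial

variable {K : Type*} [Field K] {σ : Type*} {d : ℕ}

theorem rep_chart_ne_zero (P : ℙ K (σ → K)) : P.rep (chart P) ≠ 0 :=
  (Function.ne_iff.mp P.rep_nonzero).choose_spec

theorem affineRep_chart (P : ℙ K (σ → K)) : affineRep P (chart P) = 1 :=
  div_self (rep_chart_ne_zero P)

theorem affineRep_ne_zero (P : ℙ K (σ → K)) : affineRep P ≠ 0 := fun h => by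
  have := affineRep_chart P
  rw [h] at this
  exact zero_ne_one this

theorem rep_eq_smul_affineRep (P : ℙ K (σ → K)) : P.rep = P.rep (chart P) • affineRep P := by
  funext i
  rw [Pi.smul_apply, smul_eq_mul, affineRep, mul_div_cancel₀ _ (rep_chart_ne_zero P)]

theorem mk_affineRep (P : ℙ K (σ → K)) :
    Projectivization.mk K (affineRep P) (affineRep_ne_zero P) = P := by
  conv_rhs => rw [← P.mk_rep]
  exact ((Projectivization.mk_eq_mk_iff' K _ _ _ _).mpr ⟨_, (rep_eq_smul_affineRep P).symm⟩).symm

theorem eq_smul_affineRep_mk {v : σ → K} (hv : v ≠ 0) :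
    v (chart (Projectivization.mk K v hv)) ≠ 0 ∧
      v = v (chart (Projectivization.mk K v hv)) • affineRep (Projectivization.mk K v hv) := by
  obtain ⟨a, ha⟩ := Projectivization.exists_smul_eq_mk_rep K v hv
  set P := Projectivization.mk K v hv
  have h1 : ∀ i, P.rep i = a * v i := fun i => by
    rw [← ha]
    rfl
  have h2 := rep_chart_ne_zero P
  rw [h1] at h2
  have h3 := right_ne_zero_of_mul h2
  refine ⟨h3, funext fun i => ?_⟩
  rw [Pi.smul_apply, smul_eq_mul, affineRep, h1, h1, mul_div_mul_left _ _ a.ne_zero,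
    mul_div_cancel₀ _ h3]

theorem mem_fixedPts_iff {f : ProjEndo K σ d} {P : ℙ K (σ → K)} :
    P ∈ f.fixedPts ↔ f.fixedIdeal (chart P) ≤ pointIdeal (affineRep P) := by
  have hr := rep_chart_ne_zero P
  have hF : ∀ i, eval P.rep (f.coord i) =
      P.rep (chart P) ^ d * eval (affineRep P) (f.coord i) := fun i => by
    conv_lhs => rw [rep_eq_smul_affineRep P]
    exact eval_smul_coord f _ _ i
  have h1 : P ∈ f.fixedPts ↔ ∃ a : K, ∀ i, a * P.rep i = eval P.rep (f.coord i) := by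
    rw [fixedPts, Set.mem_ofPred_eq, onPoints]
    conv_lhs => rhs; rw [← P.mk_rep]
    rw [Projectivization.mk_eq_mk_iff']
    exact exists_congr fun a => funext_iff
  rw [h1, fixedIdeal_le_pointIdeal]
  have hp : ∀ i, P.rep i = P.rep (chart P) * affineRep P i := fun i =>
    congrFun (rep_eq_smul_affineRep P) i
  constructor
  · rintro ⟨a, ha⟩
    refine ⟨affineRep_chart P, fun i => ?_⟩
    have h2 := ha i
    have h3 := ha (chart P)
    rw [hF] at h2 h3
    refine mul_left_cancel₀ (pow_ne_zero d hr) ?_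
    rw [← h2, mul_left_comm, ← h3, hp i]
    ring
  · rintro ⟨-, h⟩
    refine ⟨P.rep (chart P) ^ d * eval (affineRep P) (f.coord (chart P)) / P.rep (chart P),
      fun i => ?_⟩
    rw [hF i, h i, hp i]
    field_simp

theorem exists_coneIdeal_le_of_mem_fixedPts [IsAlgClosed K] {f : ProjEndo K σ d} (hd : 2 ≤ d)
    {P : ℙ K (σ → K)} (hP : P ∈ f.fixedPts) : ∃ v, ∃ hv : v ≠ 0, f.coneIdeal ≤ pointIdeal v ∧
      Projectivization.mk K v hv = P := by
  obtain ⟨s, hs0, hs⟩ := f.exists_coneIdeal_le_pointIdeal hd (mem_fixedPts_iff.mp hP)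
  refine ⟨s • affineRep P, smul_ne_zero hs0 (affineRep_ne_zero P), hs, ?_⟩
  conv_rhs => rw [← mk_affineRep P]
  exact (Projectivization.mk_eq_mk_iff' K _ _ _ _).mpr ⟨s, rfl⟩

theorem mk_mem_fixedPts {f : ProjEndo K σ d} {v : σ → K} (hv : v ≠ 0)
    (h : f.coneIdeal ≤ pointIdeal v) : Projectivization.mk K v hv ∈ f.fixedPts := by
  rw [mem_fixedPts_iff, fixedIdeal_le_pointIdeal]
  refine ⟨affineRep_chart _, fun i => ?_⟩
  obtain ⟨h1, h2⟩ := eq_smul_affineRep_mk hv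
  rw [coneIdeal_le_pointIdeal] at h
  set j := chart (Projectivization.mk K v hv)
  set p := affineRep (Projectivization.mk K v hv)
  have hpj : p j = 1 := affineRep_chart _
  have h3 : ∀ i, v j ^ d * eval p (f.coord i) = v j * p i := fun i => by
    rw [← eval_smul_coord, ← h2, h]
    exact congrFun h2 i
  refine mul_left_cancel₀ (pow_ne_zero d h1) ?_
  rw [h3, mul_left_comm, h3, hpj]
  ring

theorem finite_fixedPts [Fintype σ] [IsAlgClosed K] (f : ProjEndo K σ d) (hd : 2 ≤ d) :
    f.fixedPts.Finite := by
  have := f.finite_quotient_coneIdeal hd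
  have hfin : Finite {v : σ → K // f.coneIdeal ≤ pointIdeal v} := finite_zeros f.coneIdeal
  refine (Set.finite_range fun v : {v : {v : σ → K // f.coneIdeal ≤ pointIdeal v} // v.1 ≠ 0} =>
    Projectivization.mk K v.1.1 v.2).subset fun P hP => ?_
  obtain ⟨v, hv, h1, h2⟩ := exists_coneIdeal_le_of_mem_fixedPts hd hP
  exact ⟨⟨⟨v, h1⟩, hv⟩, h2⟩

end FixedPoints

/-! ### Comparing the spectra of a map, its lift and its powers -/

section Spectrum

variable {K : Type*} [Field K] {κ σ τ : Type*} [Fintype σ] {d : ℕ}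

/-- The multiplier polynomials at the fixed points, with multiplicity. -/
noncomputable def spectrum (f : ProjEndo K σ d) : Multiset (Polynomial K) :=
  ∑ᶠ P ∈ f.fixedPts, f.fixedMult P • {f.multiplierPoly P}

/-- The characteristic polynomials of the differential of the homogeneous lift at its fixed points,
with multiplicity. -/
noncomputable def coneSpectrum (f : ProjEndo K σ d) : Multiset (Polynomial K) :=
  ∑ᶠ v ∈ {v : σ → K | f.coneIdeal ≤ pointIdeal v},
    localMult f.coneIdeal v • {f.conePoly v}

/-- The fixed points of the lift are the origin and the disjoint sets `S P` of those on the line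
`P`. All points of `S P` have the same characteristic polynomial, so only their total multiplicity
matters. -/
theorem coneSpectrum_eq [IsAlgClosed K] (f : ProjEndo K σ d) (hd : 2 ≤ d) :
    f.coneSpectrum = {Polynomial.X ^ Fintype.card σ} +
      (d - 1) • f.spectrum.map fun γ => (Polynomial.X - Polynomial.C (d : K)) * γ := by
  classical
  have := f.finite_quotient_coneIdeal hd
  have hV := finite_zeros f.coneIdeal
  have hP := f.finite_fixedPts hd
  let S : ℙ K (σ → K) → Finset (σ → K) := fun P =>
    hV.toFinset.filter fun v => v (chart P) ≠ 0 ∧ v = v (chart P) • affineRep P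
  have hS : ∀ P v, v ∈ S P ↔
      f.coneIdeal ≤ pointIdeal v ∧ v (chart P) ≠ 0 ∧ v = v (chart P) • affineRep P := fun P v => by
    rw [Finset.mem_filter, Set.Finite.mem_toFinset, Set.mem_ofPred_eq]
  have hSne : ∀ P, ∀ v ∈ S P, ∃ hv : v ≠ 0, Projectivization.mk K v hv = P := fun P v hv => by
    obtain ⟨-, h1, h2⟩ := (hS P v).mp hv
    refine ⟨fun h0 => h1 (by rw [h0]; rfl), ?_⟩
    conv_rhs => rw [← mk_affineRep P]
    exact (Projectivization.mk_eq_mk_iff' K _ _ _ _).mpr ⟨_, h2.symm⟩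
  have hzero : f.coneIdeal ≤ pointIdeal (0 : σ → K) := coneIdeal_le_pointIdeal.mpr fun i =>
    f.eval_zero_coord (by omega) i
  have hunion : hV.toFinset = insert 0 (hP.toFinset.biUnion S) := by
    ext v
    rw [Finset.mem_insert, Finset.mem_biUnion, Set.Finite.mem_toFinset, Set.mem_ofPred_eq]
    constructor
    · intro hv
      by_cases h0 : v = 0
      · exact Or.inl h0
      · exact Or.inr ⟨Projectivization.mk K v h0, hP.mem_toFinset.mpr (mk_mem_fixedPts h0 hv),
          (hS _ _).mpr ⟨hv, eq_smul_affineRep_mk h0⟩⟩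
    · rintro (rfl | ⟨P, -, hv⟩)
      · exact hzero
      · exact ((hS P v).mp hv).1
  have hnotin : (0 : σ → K) ∉ hP.toFinset.biUnion S := fun h => by
    obtain ⟨P, -, h⟩ := Finset.mem_biUnion.mp h
    exact (hSne P 0 h).1 rfl
  have hdisj : Set.PairwiseDisjoint (hP.toFinset : Set (ℙ K (σ → K))) S := by
    intro P _ Q _ hPQ
    refine Finset.disjoint_left.mpr fun v hv hv' => hPQ ?_
    obtain ⟨_, h1⟩ := hSne P v hv
    obtain ⟨_, h2⟩ := hSne Q v hv'
    rw [← h1, ← h2]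
  rw [coneSpectrum, spectrum, finsum_mem_eq_finite_toFinset_sum _ hV,
    finsum_mem_eq_finite_toFinset_sum _ hP, hunion, Finset.sum_insert hnotin,
    localMult_eq_one (f.localSat_coneIdeal_zero hd), one_smul, f.conePoly_zero hd,
    Finset.sum_biUnion hdisj, ← Multiset.coe_mapAddMonoidHom, map_sum, Finset.smul_sum]
  congr 1
  refine Finset.sum_congr rfl fun P hPmem => ?_
  have hfix := mem_fixedPts_iff.mp (hP.mem_toFinset.mp hPmem)
  have hpoly : ∀ v ∈ S P, localMult f.coneIdeal v • ({f.conePoly v} : Multiset (Polynomial K)) =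
      localMult f.coneIdeal v •
        {(Polynomial.X - Polynomial.C (d : K)) * f.multiplierPoly P} := fun v hv => by
    obtain ⟨h1, h2, h3⟩ := (hS P v).mp hv
    have h4 := f.conePoly_eq_mul hd h2 (affineRep_chart P) (h3 ▸ h1)
    rw [← h3] at h4
    rw [h4]
    rfl
  rw [Finset.sum_congr rfl hpoly, ← Finset.sum_smul, f.sum_localMult_coneIdeal hd hfix (hS P),
    mul_smul, map_nsmul, Multiset.coe_mapAddMonoidHom, Multiset.map_singleton,
    fixedMult_eq_localMult]

/-- The origin's contribution and the factor `d - 1 > 0` cancel, and multiplication by `t - d` is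
injective. -/
theorem spectrum_eq_of_coneSpectrum_eq [IsAlgClosed K] {f g : ProjEndo K σ d} (hd : 2 ≤ d)
    (h : f.coneSpectrum = g.coneSpectrum) : f.spectrum = g.spectrum := by
  classical
  rw [f.coneSpectrum_eq hd, g.coneSpectrum_eq hd, add_right_inj] at h
  refine Multiset.map_injective (mul_right_injective₀ (Polynomial.X_sub_C_ne_zero (d : K))) ?_
  ext γ
  have := congrArg (Multiset.count γ) h
  rw [Multiset.count_nsmul, Multiset.count_nsmul] at this
  exact Nat.eq_of_mul_eq_mul_left (by omega) this

open Classical in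
/-- The formal sum of the elements of a multiset. -/
noncomputable def formalSum {A : Type*} : Multiset A ≃+ MonoidAlgebra ℕ A :=
  Multiset.toFinsupp.trans MonoidAlgebra.coeffAddEquiv.symm

theorem formalSum_singleton {A : Type*} (a : A) : formalSum {a} = MonoidAlgebra.single a 1 := by
  classical
  rw [formalSum, AddEquiv.trans_apply, Multiset.toFinsupp_singleton]
  rfl

theorem formalSum_nsmul_singleton {A : Type*} [Monoid A] (n : ℕ) (a : A) :
    formalSum (n • {a}) = (n : MonoidAlgebra ℕ A) * MonoidAlgebra.of ℕ A a := by
  rw [map_nsmul, formalSum_singleton, nsmul_eq_mul]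
  rfl

/-- Expanding the power gives a sum over tuples of fixed points of the lift of `f`, which are the
fixed points of the lift of `g`. Coefficients in `ℕ` rather than `K` retain the multiplicities in
positive characteristic. -/
theorem IsBlockPower.formalSum_coneSpectrum [IsAlgClosed K] [Fintype κ] [Fintype τ]
    {e : κ × σ ≃ τ} {f : ProjEndo K σ d} {g : ProjEndo K τ d} (h : IsBlockPower e f g)
    (hd : 2 ≤ d) : formalSum g.coneSpectrum = formalSum f.coneSpectrum ^ Fintype.card κ := by
  classical
  have := f.finite_quotient_coneIdeal hd
  have := g.finite_quotient_coneIdeal hd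
  have hf := finite_zeros f.coneIdeal
  have hg := finite_zeros g.coneIdeal
  rw [coneSpectrum, coneSpectrum, finsum_mem_eq_finite_toFinset_sum _ hf,
    finsum_mem_eq_finite_toFinset_sum _ hg, map_sum, map_sum, ← Finset.card_univ,
    ← Finset.prod_const, Finset.prod_univ_sum]
  refine Finset.sum_bij' (fun z _ j k => z (e (j, k)))
    (fun w _ t => w (e.symm t).1 (e.symm t).2) ?_ ?_ ?_ ?_ ?_
  · intro z hz
    rw [Set.Finite.mem_toFinset, Set.mem_ofPred_eq, h.coneIdeal_eq, blockIdeal_le_pointIdeal] at hz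
    rw [Fintype.mem_piFinset]
    exact fun j => hf.mem_toFinset.mpr (hz j)
  · intro w hw
    rw [Fintype.mem_piFinset] at hw
    rw [Set.Finite.mem_toFinset, Set.mem_ofPred_eq, h.coneIdeal_eq, blockIdeal_le_pointIdeal]
    intro j
    simpa using hf.mem_toFinset.mp (hw j)
  · intro z _
    funext t
    simp
  · intro w _
    funext j k
    simp
  · intro z _
    rw [formalSum_nsmul_singleton, h.conePoly_eq, h.coneIdeal_eq, localMult_blockIdeal, map_prod,
      Nat.cast_prod, ← Finset.prod_mul_distrib]
    exact Finset.prod_congr rfl fun j _ => (formalSum_nsmul_singleton _ _).symm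

end Spectrum

/-! ### Multiplier invariants determine the spectrum -/

section MultiplierInvariants

variable {R : Type*} [CommRing R]

theorem monic_natDegree_multiset_prod {N : ℕ} (s : Multiset (Polynomial R))
    (hs : ∀ γ ∈ s, γ.Monic ∧ γ.natDegree = N) :
    s.prod.Monic ∧ s.prod.natDegree = N * s.card := by
  have hm : s.prod.Monic := by
    have := Polynomial.monic_multiset_prod_of_monic s (fun γ => γ) fun γ hγ => (hs γ hγ).1
    rwa [Multiset.map_id'] at this
  refine ⟨hm, ?_⟩
  rw [Polynomial.natDegree_multiset_prod_of_monic s fun γ hγ => (hs γ hγ).1,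
    Multiset.map_congr rfl fun γ hγ => (hs γ hγ).2, Multiset.map_const', Multiset.sum_replicate,
    smul_eq_mul, mul_comm]

/-- A product of `i` members has degree `N * i`. Hence the labels `j ≤ N i` miss no nonzero
coefficient of `Σ_n`. -/
theorem coeff_esymm_eq_zero {N i m : ℕ} {s : Multiset (Polynomial R)}
    (hs : ∀ γ ∈ s, γ.Monic ∧ γ.natDegree = N) (hm : N * i < m) : (s.esymm i).coeff m = 0 := by
  have h : ∀ t ∈ s.powersetCard i, t.prod ∈ Polynomial.degreeLT R m := fun t ht => by
    rw [Multiset.mem_powersetCard] at ht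
    have := (monic_natDegree_multiset_prod t fun γ hγ => hs γ (Multiset.mem_of_le ht.1 hγ)).2
    rw [ht.2] at this
    exact Polynomial.mem_degreeLT.mpr (Polynomial.degree_le_natDegree.trans_lt (by
      rw [this]
      exact_mod_cast hm))
  have h2 : s.esymm i ∈ Polynomial.degreeLT R m := by
    refine multiset_sum_mem _ fun x hx => ?_
    obtain ⟨t, ht, rfl⟩ := Multiset.mem_map.mp hx
    exact h t ht
  exact Polynomial.coeff_eq_zero_of_degree_lt (Polynomial.mem_degreeLT.mp h2)

variable {K : Type*} [Field K] {σ : Type*} [Fintype σ] {d : ℕ}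

theorem monic_multiplierPoly (f : ProjEndo K σ d) (P : ℙ K (σ → K)) :
    (f.multiplierPoly P).Monic := by
  classical
  exact Matrix.charpoly_monic _

theorem natDegree_multiplierPoly (f : ProjEndo K σ d) (P : ℙ K (σ → K)) :
    (f.multiplierPoly P).natDegree = Fintype.card σ - 1 := by
  classical
  rw [multiplierPoly, Matrix.charpoly_natDegree_eq_dim]
  convert Set.card_ne_eq (chart P)

theorem mem_spectrum [IsAlgClosed K] {f : ProjEndo K σ d} (hd : 2 ≤ d) {γ : Polynomial K}
    (h : γ ∈ f.spectrum) : γ.Monic ∧ γ.natDegree = Fintype.card σ - 1 := by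
  rw [spectrum, finsum_mem_eq_finite_toFinset_sum _ (f.finite_fixedPts hd), Multiset.mem_sum] at h
  obtain ⟨P, -, hP⟩ := h
  rw [Multiset.mem_singleton.mp (Multiset.mem_of_mem_nsmul hP)]
  exact ⟨f.monic_multiplierPoly P, f.natDegree_multiplierPoly P⟩

variable [IsAlgClosed K]

theorem two_le_pow_of_ne_zero (hd : 2 ≤ d) {n : ℕ} (hn : n ≠ 0) : 2 ≤ d ^ n :=
  hd.trans (Nat.le_self_pow hn d)

theorem numPer_eq_card (f : ProjEndo K σ d) (hd : 2 ≤ d) {n : ℕ} (hn : n ≠ 0) :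
    f.numPer n = (f.iter n).spectrum.card := by
  have hfin := (f.iter n).finite_fixedPts (two_le_pow_of_ne_zero hd hn)
  rw [numPer, spectrum, finsum_mem_eq_finite_toFinset_sum _ hfin,
    finsum_mem_eq_finite_toFinset_sum _ hfin, Multiset.card_sum]
  simp

theorem bigSigma_eq_prod (f : ProjEndo K σ d) (hd : 2 ≤ d) {n : ℕ} (hn : n ≠ 0) :
    f.bigSigma n =
      ((f.iter n).spectrum.map fun γ => Polynomial.X - Polynomial.C γ).prod := by
  have hfin := (f.iter n).finite_fixedPts (two_le_pow_of_ne_zero hd hn)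
  rw [bigSigma, spectrum, finprod_mem_eq_finite_toFinset_prod _ hfin,
    finsum_mem_eq_finite_toFinset_sum _ hfin, ← Multiset.coe_mapAddMonoidHom, map_sum,
    Multiset.prod_sum]
  refine Finset.prod_congr rfl fun P _ => ?_
  rw [map_nsmul, Multiset.prod_nsmul, Multiset.coe_mapAddMonoidHom, Multiset.map_singleton,
    Multiset.prod_singleton]

theorem multInv_eq_of_spectrum_eq {f g : ProjEndo K σ d} (hd : 2 ≤ d) {n : ℕ} (hn : n ≠ 0)
    (h : (f.iter n).spectrum = (g.iter n).spectrum) (i j : ℕ) :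
    f.multInv n i j = g.multInv n i j := by
  rw [multInv, multInv, numPer_eq_card f hd hn, numPer_eq_card g hd hn, bigSigma_eq_prod f hd hn,
    bigSigma_eq_prod g hd hn, h]

/-- This is the leading coefficient of the product of all the multiplier polynomials. As the
invariants are set to `0` beyond `i = D_n`, it makes `D_n` recoverable from them. -/
theorem multInv_numPer_zero (f : ProjEndo K σ d) (hd : 2 ≤ d) {n : ℕ} (hn : n ≠ 0) :
    f.multInv n (f.numPer n) 0 = 1 := by
  have hm := monic_natDegree_multiset_prod _ fun γ hγ =>
    mem_spectrum (two_le_pow_of_ne_zero hd hn) (f := f.iter n) hγ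
  have h1 : (f.iter n).spectrum.prod.coeff
      ((Fintype.card σ - 1) * (f.iter n).spectrum.card) = 1 := by
    rw [← hm.2]
    exact hm.1
  rw [multInv, if_pos ⟨le_rfl, Nat.zero_le _⟩, Nat.sub_self, Nat.sub_zero, add_zero,
    bigSigma_eq_prod f hd hn, numPer_eq_card f hd hn, Multiset.prod_X_sub_C_coeff _ (Nat.zero_le _),
    Nat.sub_zero, Multiset.esymm, Multiset.powersetCard_self, Multiset.map_singleton,
    Multiset.sum_singleton, ← Polynomial.C_1, ← Polynomial.C_neg, ← Polynomial.C_pow,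
    Polynomial.coeff_C_mul, h1, mul_one, ← mul_pow, neg_one_mul, neg_neg, one_pow]

theorem numPer_le_of_multInv_eq {f g : ProjEndo K σ d} (hd : 2 ≤ d) {n : ℕ} (hn : n ≠ 0)
    (h : ∀ i j, f.multInv n i j = g.multInv n i j) : f.numPer n ≤ g.numPer n := by
  by_contra hlt
  have h1 := f.multInv_numPer_zero hd hn
  rw [h, multInv, if_neg fun h => hlt h.1] at h1
  exact zero_ne_one h1

theorem coeff_coeff_bigSigma_eq_zero (f : ProjEndo K σ d) (hd : 2 ≤ d) {n : ℕ} (hn : n ≠ 0)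
    {k m : ℕ} (hk : k ≤ f.numPer n) (hm : (Fintype.card σ - 1) * (f.numPer n - k) < m) :
    ((f.bigSigma n).coeff k).coeff m = 0 := by
  rw [numPer_eq_card f hd hn] at hk hm
  rw [bigSigma_eq_prod f hd hn, Multiset.prod_X_sub_C_coeff _ hk, ← Polynomial.C_1,
    ← Polynomial.C_neg, ← Polynomial.C_pow, Polynomial.coeff_C_mul,
    coeff_esymm_eq_zero (fun γ hγ => mem_spectrum (two_le_pow_of_ne_zero hd hn) hγ) hm, mul_zero]

theorem coeff_bigSigma_eq_zero (f : ProjEndo K σ d) (hd : 2 ≤ d) {n : ℕ} (hn : n ≠ 0) {k : ℕ}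
    (hk : f.numPer n < k) : (f.bigSigma n).coeff k = 0 := by
  refine Polynomial.coeff_eq_zero_of_natDegree_lt ?_
  rwa [bigSigma_eq_prod f hd hn, Polynomial.natDegree_multiset_prod_X_sub_C_eq_card,
    ← numPer_eq_card f hd hn]

theorem spectrum_eq_of_multInv_eq {f g : ProjEndo K σ d} (hd : 2 ≤ d) {n : ℕ} (hn : n ≠ 0)
    (h : ∀ i j, f.multInv n i j = g.multInv n i j) :
    (f.iter n).spectrum = (g.iter n).spectrum := by
  have hper : f.numPer n = g.numPer n := le_antisymm (numPer_le_of_multInv_eq hd hn h)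
    (numPer_le_of_multInv_eq hd hn fun i j => (h i j).symm)
  have hsigma : f.bigSigma n = g.bigSigma n := by
    ext k m
    rcases lt_or_ge (f.numPer n) k with hk | hk
    · rw [coeff_bigSigma_eq_zero f hd hn hk, coeff_bigSigma_eq_zero g hd hn (hper ▸ hk)]
    rcases lt_or_ge ((Fintype.card σ - 1) * (f.numPer n - k)) m with hm | hm
    · rw [coeff_coeff_bigSigma_eq_zero f hd hn hk hm,
        coeff_coeff_bigSigma_eq_zero g hd hn (hper ▸ hk) (hper ▸ hm)]
    -- The coefficient of `w ^ k t ^ m` carries the labels `i = D_n - k` and `j = N i - m`.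
    have h1 := h (f.numPer n - k) ((Fintype.card σ - 1) * (f.numPer n - k) - m)
    rw [multInv, multInv, ← hper, if_pos ⟨Nat.sub_le _ _, Nat.sub_le _ _⟩,
      if_pos ⟨Nat.sub_le _ _, Nat.sub_le _ _⟩, Nat.sub_sub_self hk, Nat.sub_sub_self hm] at h1
    exact mul_left_cancel₀ (pow_ne_zero _ (neg_ne_zero.mpr one_ne_zero)) h1
  rw [bigSigma_eq_prod f hd hn, bigSigma_eq_prod g hd hn] at hsigma
  -- Over the domain `K[t]`, the roots of `Σ_n` in `w` are the multiplier polynomials with their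
  -- multiplicities.
  have := congrArg Polynomial.roots hsigma
  rwa [Polynomial.roots_multiset_prod_X_sub_C, Polynomial.roots_multiset_prod_X_sub_C] at this

theorem isospectral_iff_spectrum {f g : ProjEndo K σ d} (hd : 2 ≤ d) :
    Isospectral f g ↔ ∀ n ≠ 0, (f.iter n).spectrum = (g.iter n).spectrum := by
  constructor
  · intro h n hn
    obtain ⟨m, rfl⟩ := Nat.exists_eq_succ_of_ne_zero hn
    exact spectrum_eq_of_multInv_eq hd hn fun i j =>
      congrFun (congrFun (congrFun (h (m + 1)) (Fin.last m)) i) j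
  · intro h n
    funext k i j
    exact multInv_eq_of_spectrum_eq hd (Nat.succ_ne_zero _) (h _ (Nat.succ_ne_zero _)) i j

end MultiplierInvariants

/-! ### Rescaling and iteration -/

section SameMap

open MvPolynomial

variable {K : Type*} [Field K] {κ σ τ : Type*} {d : ℕ}

theorem SameMap.symm {f g : ProjEndo K σ d} (h : SameMap f g) : SameMap g f := by
  obtain ⟨c, hc, h⟩ := h
  refine ⟨c⁻¹, inv_ne_zero hc, fun i => ?_⟩
  rw [h, ← mul_assoc, ← C_mul, inv_mul_cancel₀ hc, C_1, one_mul]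

theorem SameMap.fixedIdeal_le {f g : ProjEndo K σ d} (h : SameMap f g) (j : σ) :
    f.fixedIdeal j ≤ g.fixedIdeal j := by
  obtain ⟨c, -, h⟩ := h
  rw [fixedIdeal, Ideal.span_le]
  rintro _ (rfl | ⟨v, w, rfl⟩)
  · exact g.X_sub_one_mem_fixedIdeal j
  · have := Ideal.mul_mem_left _ (C c) (g.minor_mem_fixedIdeal j v w)
    rw [mul_sub, mul_left_comm, mul_left_comm (C c) (X w), ← h, ← h] at this
    exact this

theorem SameMap.fixedIdeal_eq {f g : ProjEndo K σ d} (h : SameMap f g) (j : σ) :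
    f.fixedIdeal j = g.fixedIdeal j := le_antisymm (h.fixedIdeal_le j) (h.symm.fixedIdeal_le j)

theorem SameMap.jacobian_eq {f g : ProjEndo K σ d} (h : SameMap f g) (j : σ) (p : σ → K) :
    f.jacobian j p = g.jacobian j p := by
  obtain ⟨c, hc, h⟩ := h
  ext v w
  simp only [jacobian, Matrix.of_apply, h, pderiv_C_mul, eval_C, map_mul]
  rw [← mul_div_mul_left _ (eval p (g.coord j) ^ 2) (pow_ne_zero 2 hc)]
  congr 1 <;> ring

/-- Rescaling moves the fixed points of the lift in general, so the comparison is made in projective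
space, where the minors change by a scalar and the ratios `f_v / f_j` not at all. -/
theorem SameMap.spectrum_eq [Fintype σ] {f g : ProjEndo K σ d} (h : SameMap f g) :
    f.spectrum = g.spectrum := by
  have h1 : f.fixedPts = g.fixedPts := by
    ext P
    rw [mem_fixedPts_iff, mem_fixedPts_iff, h.fixedIdeal_eq]
  have h2 : ∀ P, f.fixedMult P = g.fixedMult P := fun P => by
    rw [fixedMult_eq_localMult, fixedMult_eq_localMult, h.fixedIdeal_eq]
  have h3 : ∀ P, f.multiplierPoly P = g.multiplierPoly P := fun P => by
    rw [multiplierPoly, multiplierPoly, h.jacobian_eq]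
  simp only [spectrum, h1, h2, h3]

theorem SameMap.comp {e : ℕ} {f f' : ProjEndo K σ d} {g g' : ProjEndo K σ e} (hf : SameMap f f')
    (hg : SameMap g g') : SameMap (f.comp g) (f'.comp g') := by
  obtain ⟨a, ha, hf⟩ := hf
  obtain ⟨b, hb, hg⟩ := hg
  refine ⟨a * b ^ d, mul_ne_zero ha (pow_ne_zero d hb), fun i => ?_⟩
  change bind₁ g.coord (f.coord i) = _ * bind₁ g'.coord (f'.coord i)
  rw [hf, map_mul, bind₁_C_right, show g.coord = fun k => C b * g'.coord k from funext hg, bind₁,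
    aeval_mul_of_isHomogeneous (f'.homog i), C_mul, C_pow, mul_assoc]
  rfl

theorem SameMap.iter {f g : ProjEndo K σ d} (h : SameMap f g) (n : ℕ) :
    SameMap (f.iter n) (g.iter n) := by
  induction n with
  | zero => exact ⟨1, one_ne_zero, fun i => by rw [C_1, one_mul]; rfl⟩
  | succ n ih => exact h.comp ih

theorem IsBlockPower.iter {e : κ × σ ≃ τ} {f : ProjEndo K σ d} {g : ProjEndo K τ d}
    (h : IsBlockPower e f g) (n : ℕ) : IsBlockPower e (f.iter n) (g.iter n) := by
  induction n with
  | zero =>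
    intro q
    change X (e q) = rename _ (X q.2)
    rw [rename_X]
  | succ n ih =>
    intro q
    change bind₁ (g.iter n).coord (g.coord (e q)) =
      rename _ (bind₁ (f.iter n).coord (f.coord q.2))
    rw [h q, bind₁_rename, rename_bind₁]
    exact congrArg (fun φ => bind₁ φ (f.coord q.2)) (funext fun k => ih (q.1, k))

end SameMap

/-! ### The map induced through the Segre embedding -/

section Segre

open MvPolynomial

variable {K : Type*} [Field K] {σ τ : Type*} {d : ℕ}

/-- The map acting by `f` on each of the rows `(z_{kl})_k` of the coordinates `z_{kl}`. -/
noncomputable def rowwise (τ : Type*) (f : ProjEndo K σ d) : ProjEndo K (σ × τ) d :=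
  permute (Equiv.prodComm τ σ) (cartProd fun _ : τ => f)

theorem rowwise_coord (f : ProjEndo K σ d) (i : σ) (j : τ) :
    (rowwise τ f).coord (i, j) = rename (fun k => (k, j)) (f.coord i) := by
  change rename _ (rename _ _) = _
  rw [rename_rename]
  rfl

theorem isBlockPower_rowwise (τ : Type*) (f : ProjEndo K σ d) :
    IsBlockPower (Equiv.prodComm τ σ) f (rowwise τ f) := fun q => rowwise_coord f q.2 q.1

theorem rename_eq_aeval (φ : σ → τ) (F : MvPolynomial σ K) :
    rename φ F = aeval (fun k => (X (φ k) : MvPolynomial τ K)) F := by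
  have : rename φ = aeval (fun k => (X (φ k) : MvPolynomial τ K)) := by
    ext k
    simp
  rw [this]

theorem segrePullback_monomial (m : σ × τ →₀ ℕ) :
    segrePullback K σ τ (monomial m 1) =
      monomial (m.mapDomain (Sum.inl ∘ Prod.fst) + m.mapDomain (Sum.inr ∘ Prod.snd)) 1 := by
  have h : (monomial (m.mapDomain (Sum.inl ∘ Prod.fst) + m.mapDomain (Sum.inr ∘ Prod.snd)) 1 :
      MvPolynomial (σ ⊕ τ) K) = rename (Sum.inl ∘ Prod.fst) (monomial m 1) *
        rename (Sum.inr ∘ Prod.snd) (monomial m 1) := by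
    rw [rename_monomial, rename_monomial, monomial_mul, one_mul]
  rw [h, segrePullback, rename_eq_aeval, rename_eq_aeval, aeval_monomial, aeval_monomial, aeval_monomial, map_one,
    one_mul, one_mul, one_mul, ← Finsupp.prod_mul]
  exact Finsupp.prod_congr fun q _ => mul_pow _ _ _

theorem segrePullback_rename {F : MvPolynomial σ K} (hF : F.IsHomogeneous d) (j : τ) :
    segrePullback K σ τ (rename (fun k => (k, j)) F) = rename Sum.inl F * X (Sum.inr j) ^ d := by
  rw [segrePullback, aeval_rename, mul_comm, rename_eq_aeval, ← aeval_mul_of_isHomogeneous hF]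
  exact congrArg (fun φ => aeval φ F) (funext fun k => mul_comm _ _)

theorem segreCoord_power (f : ProjEndo K σ d) (i : σ) (j : τ) :
    segreCoord f (power K τ d) (i, j) = rename Sum.inl (f.coord i) * X (Sum.inr j) ^ d := by
  rw [segreCoord, power, map_pow, rename_X]

theorem segreInduced_rowwise (f : ProjEndo K σ d) :
    SegreInduced f (power K τ d) (rowwise τ f) := by
  refine ⟨⟨1, one_ne_zero, fun ⟨i, j⟩ => ?_⟩, fun ⟨i, j⟩ m hm => ?_⟩
  · rw [C_1, one_mul, segreCoord_power, rowwise_coord, segrePullback_rename (f.homog i)]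
  · have hinj : Function.Injective fun k : σ => (k, j) := fun a b h => (Prod.mk.inj h).1
    rw [mem_support_iff, rowwise_coord] at hm
    obtain ⟨a, rfl, ha⟩ := coeff_rename_ne_zero _ _ _ hm
    have hdeg : (monomial a (1 : K)).IsHomogeneous d :=
      isHomogeneous_monomial _ (f.homog i |>.degree_eq_sum_deg_support (mem_support_iff.mpr ha)).symm
    have h1 := segrePullback_rename hdeg j
    rw [rename_monomial, rename_monomial, X_pow_eq_monomial, monomial_mul, one_mul] at h1
    rw [h1]
    refine support_monomial_subset.trans (Finset.singleton_subset_iff.mpr ?_)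
    rw [mem_support_iff, segreCoord_power, X_pow_eq_monomial, coeff_mul_monomial, mul_one,
      coeff_rename_mapDomain _ Sum.inl_injective]
    exact ha

/-- The support condition confines `h_{ij}` to the variables `z_{kj}`; there the pullback condition
determines it, as setting `y = 1` inverts the pullback. -/
theorem SegreInduced.sameMap_rowwise {f : ProjEndo K σ d} {h : ProjEndo K (σ × τ) d}
    (hh : SegreInduced f (power K τ d) h) : SameMap h (rowwise τ f) := by
  classical
  obtain ⟨⟨c, hc, h1⟩, h2⟩ := hh
  refine ⟨c, hc, ?_⟩
  rintro ⟨i, j⟩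
  -- If `z_{kl}` divides a monomial of `h_{ij}`, then `y_l` divides its pullback. The latter is a
  -- monomial of `f_i(x) y_j ^ d`, so `l = j`.
  have hvars : ((h.coord (i, j)).vars : Set (σ × τ)) ⊆ Set.range fun k => (k, j) := by
    rintro ⟨k, l⟩ hkl
    obtain ⟨m, hm, hmkl⟩ := (mem_vars_iff_mem_support _).mp (Finset.mem_coe.mp hkl)
    rw [Finsupp.mem_support_iff] at hmkl
    have h3 := h2 (i, j) m hm
    rw [segrePullback_monomial, support_monomial, if_neg one_ne_zero, Finset.singleton_subset_iff,
      segreCoord_power] at h3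
    obtain ⟨a, ha, b, hb, hab⟩ := Finset.mem_add.mp (support_mul _ _ h3)
    obtain ⟨a, rfl, -⟩ := coeff_rename_ne_zero _ _ _ (mem_support_iff.mp ha)
    rw [support_X_pow, Finset.mem_singleton] at hb
    have h4 := DFunLike.congr_fun hab (Sum.inr l)
    rw [Finsupp.add_apply, Finsupp.add_apply, Finsupp.mapDomain_of_notMem_range _ _ (by simp), hb,
      zero_add, ← Finsupp.single_add_erase (k, l) m, Finsupp.mapDomain_add (f := Sum.inr ∘ _),
      Finsupp.add_apply (Finsupp.mapDomain _ _), Finsupp.mapDomain_single, Function.comp_apply,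
      Finsupp.single_eq_same] at h4
    by_cases hlj : j = l
    · exact ⟨k, by rw [hlj]⟩
    · rw [Finsupp.single_eq_of_ne (by simpa using Ne.symm hlj)] at h4
      omega
  obtain ⟨g, hg⟩ := exists_rename_eq_of_vars_subset_range _ (fun k => (k, j))
    (fun a b h => (Prod.mk.inj h).1) hvars
  have h3 := h1 (i, j)
  rw [← hg, segreCoord_power] at h3
  let θ : MvPolynomial (σ ⊕ τ) K →ₐ[K] MvPolynomial σ K := aeval (Sum.elim X fun _ => 1)
  have h4 := congrArg θ h3
  have h5 : ∀ r, θ (segrePullback K σ τ (rename (fun k => (k, j)) r)) = r := by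
    intro r
    have : (θ.comp (segrePullback K σ τ)).comp (rename fun k => (k, j)) =
        AlgHom.id K (MvPolynomial σ K) := by
      ext k
      simp [segrePullback, θ]
    exact DFunLike.congr_fun this r
  have h6 : ∀ r, θ (rename Sum.inl r) = r := by
    intro r
    have : θ.comp (rename Sum.inl) = AlgHom.id K (MvPolynomial σ K) := by
      ext k
      simp [θ]
    exact DFunLike.congr_fun this r
  rw [h5, map_mul, map_mul, map_pow, aeval_X, Sum.elim_inr, one_pow, mul_one, h6, ← algebraMap_eq,
    AlgHom.commutes, algebraMap_eq] at h4
  rw [← hg, rowwise_coord, h4, map_mul, rename_C]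

/-- Equal spectra of the iterates give equal cone spectra, hence equal powers of their formal sums,
which are the cone spectra of the products; these in turn determine the spectra. -/
theorem isospectral_rowwise [IsAlgClosed K] [Fintype σ] [Fintype τ] {f g : ProjEndo K σ d}
    (hd : 2 ≤ d) (h : Isospectral f g) : Isospectral (rowwise τ f) (rowwise τ g) := by
  rw [isospectral_iff_spectrum hd] at h ⊢
  intro n hn
  have hdn := two_le_pow_of_ne_zero hd hn
  refine spectrum_eq_of_coneSpectrum_eq hdn (formalSum.injective ?_)
  rw [((isBlockPower_rowwise τ f).iter n).formalSum_coneSpectrum hdn,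
    ((isBlockPower_rowwise τ g).iter n).formalSum_coneSpectrum hdn, coneSpectrum_eq _ hdn,
    coneSpectrum_eq _ hdn, h n hn]

theorem Isospectral.of_sameMap [IsAlgClosed K] [Fintype σ] {f g : ProjEndo K σ d} (hd : 2 ≤ d)
    (h : SameMap f g) : Isospectral f g :=
  (isospectral_iff_spectrum hd).mpr fun n _ => (h.iter n).spectrum_eq

end Segre

end ProjEndo

theorem mainTheorem5 {K : Type*} [Field K] [IsAlgClosed K] {ι : Type*} (N M d : ℕ) (hd : 2 ≤ d)
    (f : ι → ProjEndo K (Fin (N + 1)) d) (hf : ProjEndo.IsospectralFamily f) :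
    (∀ a, ∃ h : ProjEndo K (Fin (N + 1) × Fin (M + 1)) d,
      ProjEndo.SegreInduced (f a) (ProjEndo.power K (Fin (M + 1)) d) h ∧
      ∀ h', ProjEndo.SegreInduced (f a) (ProjEndo.power K (Fin (M + 1)) d) h' →
        ProjEndo.SameMap h' h) ∧
    ∀ h : ι → ProjEndo K (Fin (N + 1) × Fin (M + 1)) d,
      (∀ a, ProjEndo.SegreInduced (f a) (ProjEndo.power K (Fin (M + 1)) d) (h a)) →
        ProjEndo.IsospectralFamily h ∧
        ∃ e : Fin (N + 1) × Fin (M + 1) ≃ Fin (M + 1) × Fin (N + 1), ∀ a,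
          ProjEndo.SameMap (ProjEndo.permute e (h a))
            (ProjEndo.cartProd fun _ : Fin (M + 1) => f a) := by
  refine ⟨fun a => ⟨ProjEndo.rowwise (Fin (M + 1)) (f a), ProjEndo.segreInduced_rowwise (f a),
    fun h' hh' => hh'.sameMap_rowwise⟩, fun h hh => ⟨fun a b n => ?_, Equiv.prodComm _ _,
      fun a => ?_⟩⟩
  · have ha := ProjEndo.Isospectral.of_sameMap hd (hh a).sameMap_rowwise
    have hb := ProjEndo.Isospectral.of_sameMap hd (hh b).sameMap_rowwise
    exact (ha n).trans ((ProjEndo.isospectral_rowwise hd (hf a b) n).trans (hb n).symm)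
  · obtain ⟨c, hc, hc'⟩ := (hh a).sameMap_rowwise
    refine ⟨c, hc, fun ⟨j, i⟩ => ?_⟩
    change MvPolynomial.rename _ ((h a).coord (i, j)) = _
    rw [hc', map_mul, MvPolynomial.rename_C, ProjEndo.rowwise_coord, MvPolynomial.rename_rename]
    rfl
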